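/- A semigroup $S$ is nilpotent of degree $3$ if $r=3$ is the least positive integer such that the set $S^r=\{s_1s_2\cdots s_r : s_1,\dots,s_r\in S\}$ has exactly one element. An anti-isomorphism $S\to T$ is an isomorphism from the dual $S^*$ of $S$ (the set $S$ with product $x*y=yx$) to $T$. For a partition $j$ of a nonnegative integer (written $j\vdash r$) let $j_i$ be the number of its summands equal to $i$. For integers $1\le q<p$ let $$N(p,q)=\sum_{j\vdash q-1}\ \sum_{k\vdash p-q}\Bigl(\prod_{i=1}^{q-1}j_i!\,i^{j_i}\prod_{i=1}^{p-q}k_i!\,i^{k_i}\Bigr)^{-1}\prod_{a,b=1}^{p-q}\Bigl(1+\sum_{d\mid\operatorname{lcm}(a,b)}d\,j_d\Bigr)^{k_ak_b\gcd(a,b)}$$ and $$L(p,q)=\tfrac12N(p,q)+\tfrac12\sum_{j\vdash q-1}\ \sum_{k\vdash p-q}\Bigl(\prod_{i=1}^{q-1}j_i!\,i^{j_i}\prod_{i=1}^{p-q}k_i!\,i^{k_i}\Bigr)^{-1}\prod_{a=1}^{p-q}\Bigl(q_a^{k_a}\,p_{a,a}^{k_a^2-k_a}\prod_{b=1}^{a-1}p_{a,b}^{2k_ak_b}\Bigr),$$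 where, for the given partition $j$, $$p_{a,b}=\Bigl(1+\sum_{d\mid\operatorname{lcm}(2,a,b)}d\,j_d\Bigr)^{ab/\operatorname{lcm}(2,a,b)}$$ (a positive real power; the exponent may be a half-integer) and $$q_a=\begin{cases}\bigl(1+\sum_{d\mid a}d\,j_d\bigr)\bigl(1+\sum_{d\mid 2a}d\,j_d\bigr)^{(a-1)/2}&\text{if }a\equiv1\bmod 2,\\[2pt]\bigl(1+\sum_{d\mid a}d\,j_d\bigr)^{a}&\text{if }a\equiv0\bmod4,\\[2pt]\bigl(1+\sum_{d\mid a/2}d\,j_d\bigr)^2\bigl(1+\sum_{d\mid a}d\,j_d\bigr)^{a-1}&\text{if }a\equiv2\bmod4.\end{cases}$$ Then for every integer $n\ge1$ the number of nilpotent semigroups of degree $3$ and order $n$ (that is, of such semigroup structures on any fixed set with $n$ elements), counted up to isomorphism or anti-isomorphism, equals $$\sum_{m=2}^{a(n)}\bigl(L(n,m)-L(n-1,m-1)\bigr),\qquad a(n)=\Bigl\lfloor n+\tfrac12-\sqrt{n-\tfrac34}\,\Bigr\rfloor .$$ -/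

import Mathlib

/-- `S^r`: the set of all products `s₁ s₂ ⋯ s_r` of `r` elements of the semigroup `S`
(meaningful for `r ≥ 1`; there is no product of `0` elements). -/
def productSet (S : Type*) [Semigroup S] (r : ℕ) : Set S :=
  {x | ∃ (s : S) (l : List S), l.length + 1 = r ∧ l.foldl (fun u v => u * v) s = x}

/-- `S` is nilpotent of degree `r`: `r` is the least positive integer with `|S^r| = 1`. -/
def IsNilpotentOfDegree (S : Type*) [Semigroup S] (r : ℕ) : Prop :=
  IsLeast {t : ℕ | 1 ≤ t ∧ (productSet S t).ncard = 1} r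

/-- `S` and `T` are isomorphic or anti-isomorphic; an anti-isomorphism is an isomorphism
from the dual (opposite) semigroup of `S` to `T`. -/
def IsoOrAntiIso (S T : Type*) [Semigroup S] [Semigroup T] : Prop :=
  Nonempty (S ≃* T) ∨ Nonempty (Sᵐᵒᵖ ≃* T)

theorem IsoOrAntiIso.refl (S : Type*) [Semigroup S] : IsoOrAntiIso S S :=
  Or.inl ⟨MulEquiv.refl S⟩

theorem IsoOrAntiIso.symm {S T : Type*} [Semigroup S] [Semigroup T]
    (h : IsoOrAntiIso S T) : IsoOrAntiIso T S := by
  rcases h with ⟨⟨f⟩⟩ | ⟨⟨f⟩⟩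
  · exact Or.inl ⟨f.symm⟩
  · exact Or.inr ⟨(MulEquiv.op f.symm).trans (MulEquiv.opOp S).symm⟩

theorem IsoOrAntiIso.trans {S T U : Type*} [Semigroup S] [Semigroup T] [Semigroup U]
    (h : IsoOrAntiIso S T) (h' : IsoOrAntiIso T U) : IsoOrAntiIso S U := by
  rcases h with ⟨⟨f⟩⟩ | ⟨⟨f⟩⟩ <;> rcases h' with ⟨⟨g⟩⟩ | ⟨⟨g⟩⟩
  · exact Or.inl ⟨f.trans g⟩
  · exact Or.inr ⟨(MulEquiv.op f).trans g⟩
  · exact Or.inr ⟨f.trans g⟩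
  · exact Or.inl ⟨((MulEquiv.opOp S).trans (MulEquiv.op f)).trans g⟩

/-- The semigroup structures on the set `X` that are nilpotent of degree `3`. -/
def NilpotentDegThree (X : Type*) : Type _ :=
  {M : Semigroup X // @IsNilpotentOfDegree X M 3}

/-- Isomorphism or anti-isomorphism of semigroup structures on `X`. -/
def isoOrAntiIsoSetoid (X : Type*) : Setoid (NilpotentDegThree X) where
  r M M' := @IsoOrAntiIso X X M.1 M'.1
  iseqv :=
    { refl := fun M => @IsoOrAntiIso.refl X M.1
      symm := fun {M M'} h => @IsoOrAntiIso.symm X X M.1 M'.1 h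
      trans := fun {M M' M''} h h' => @IsoOrAntiIso.trans X X X M.1 M'.1 M''.1 h h' }

/-- The number of nilpotent semigroups of degree `3` on the set `X`, up to isomorphism or
anti-isomorphism. -/
noncomputable def numNilpotentUpToEquiv (X : Type*) : ℕ :=
  Nat.card (Quotient (isoOrAntiIsoSetoid X))

/-- `j_i`: the number of summands of the partition `j` that equal `i`. -/
def Nat.Partition.mult {n : ℕ} (j : n.Partition) (i : ℕ) : ℕ :=
  j.parts.count i

/-- `∏_{i=1}^n j_i! i^{j_i}` for a partition `j` of `n`. -/
def Nat.Partition.centralizerOrder {n : ℕ} (j : n.Partition) : ℕ :=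
  ∏ i ∈ Finset.Icc 1 n, (j.mult i).factorial * i ^ j.mult i

/-- `1 + ∑_{d ∣ l} d j_d`. -/
def Nat.Partition.divisorTerm {n : ℕ} (j : n.Partition) (l : ℕ) : ℕ :=
  1 + ∑ d ∈ l.divisors, d * j.mult d

/-- `N(p,q)`, for `1 ≤ q < p`. -/
noncomputable def formulaN (p q : ℕ) : ℝ :=
  ∑ j : (q - 1).Partition, ∑ k : (p - q).Partition,
    ((j.centralizerOrder : ℝ) * (k.centralizerOrder : ℝ))⁻¹ *
      ∏ a ∈ Finset.Icc 1 (p - q), ∏ b ∈ Finset.Icc 1 (p - q),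
        (j.divisorTerm (Nat.lcm a b) : ℝ) ^ (k.mult a * k.mult b * Nat.gcd a b)

/-- `p_{a,b} = (1 + ∑_{d ∣ lcm(2,a,b)} d j_d) ^ (ab / lcm(2,a,b))`. The exponent is a rational
number (half an integer if `a` and `b` are odd), so this is a real power with base `≥ 1`. -/
noncomputable def factorP {n : ℕ} (j : n.Partition) (a b : ℕ) : ℝ :=
  (j.divisorTerm (Nat.lcm 2 (Nat.lcm a b)) : ℝ) ^
    (((a : ℝ) * (b : ℝ)) / (Nat.lcm 2 (Nat.lcm a b) : ℝ))

/-- `q_a`, by the residue of `a` modulo `4`; the divisions `(a-1)/2` and `a/2` are exact in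
the cases where they occur. -/
noncomputable def factorQ {n : ℕ} (j : n.Partition) (a : ℕ) : ℝ :=
  if a % 2 = 1 then
    (j.divisorTerm a : ℝ) * (j.divisorTerm (2 * a) : ℝ) ^ ((a - 1) / 2)
  else if a % 4 = 0 then
    (j.divisorTerm a : ℝ) ^ a
  else
    (j.divisorTerm (a / 2) : ℝ) ^ 2 * (j.divisorTerm a : ℝ) ^ (a - 1)

/-- `L(p,q)`, for `1 ≤ q < p`. -/
noncomputable def formulaL (p q : ℕ) : ℝ :=
  1 / 2 * formulaN p q +
    1 / 2 * ∑ j : (q - 1).Partition, ∑ k : (p - q).Partition,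
      ((j.centralizerOrder : ℝ) * (k.centralizerOrder : ℝ))⁻¹ *
        ∏ a ∈ Finset.Icc 1 (p - q),
          (factorQ j a ^ k.mult a * factorP j a a ^ (k.mult a ^ 2 - k.mult a) *
            ∏ b ∈ Finset.Icc 1 (a - 1), factorP j a b ^ (2 * k.mult a * k.mult b))

/-- `a(n) = ⌊n + 1/2 - √(n - 3/4)⌋`. -/
noncomputable def boundA (n : ℕ) : ℕ :=
  ⌊(n : ℝ) + 1 / 2 - Real.sqrt ((n : ℝ) - 3 / 4)⌋₊

/-! In a nilpotent semigroup of degree 3 every triple product is the zero `z`. Put `B = S² \ {z}`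
and let `A` be the complement of `S²`. A product with a factor in `S²` is `z`, so the multiplication
is a table `A × A → B ∪ {0}` in which every element of `B` occurs. Conversely, any table is
associative, both bracketings being zero. Isomorphism or anti-isomorphism becomes the orbit relation
of `Sym A × Sym B × ℤ/2` on full tables (`isoOrAntiIso_iff_mem_orbit`).

By Burnside, `L(p, q)` counts the orbits of all tables with `|A| = p - q` and `|B| = q - 1`
(`card_orbits_eq_formulaL`). A table that misses a value is, up to relabeling, a table with one
value fewer, so `L(n, m) - L(n-1, m-1)` counts the classes with `|S²| = m` (`card_isFullOrbit_add`).
Fullness forces `m - 1 ≤ (n - m)²`, that is, `m ≤ a(n)`.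

The tables fixed by a group element are equivariant maps, counted by a product over the cycles on `A
× A`. Each cycle factor is spread evenly over the points of the cycle as a real root, so only the
period of each pair is needed. With transposition, pairs on distinct cycles give `p_{a,b}` and pairs
on one cycle give `q_a`. -/

open Equiv.Perm Function

/-! ### Cycles and minimal periods -/

theorem Equiv.Perm.minimalPeriod_pos {P : Type*} [Finite P] (T : Equiv.Perm P) (x : P) :
    0 < minimalPeriod T x :=
  minimalPeriod_pos_of_mem_periodicPts (T.injective.mem_periodicPts x)

theorem Equiv.Perm.sameCycle_iff_exists_iterate {P : Type*} [Finite P] (T : Equiv.Perm P)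
    (x y : P) : T.SameCycle x y ↔ ∃ i < minimalPeriod T x, T^[i] x = y := by
  constructor
  · intro h
    obtain ⟨i, rfl⟩ := h.exists_nat_pow_eq
    exact ⟨i % minimalPeriod T x, Nat.mod_lt _ (T.minimalPeriod_pos x), by
      rw [iterate_mod_minimalPeriod_eq, Equiv.Perm.iterate_eq_pow]⟩
  · rintro ⟨i, -, rfl⟩
    rw [Equiv.Perm.iterate_eq_pow, sameCycle_pow_right]

theorem Equiv.Perm.prod_sameCycle {P M : Type*} [Fintype P] [DecidableEq P] [CommMonoid M]
    (T : Equiv.Perm P) (x : P) (f : P → M) :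
    ∏ y with T.SameCycle x y, f y = ∏ i ∈ Finset.range (minimalPeriod T x), f (T^[i] x) := by
  symm
  apply Finset.prod_bij (fun i _ => T^[i] x)
  · intro i hi
    simpa [sameCycle_iff_exists_iterate] using ⟨i, by simpa using hi, rfl⟩
  · intro i hi j hj h
    exact (iterate_eq_iterate_iff_of_lt_minimalPeriod (by simpa using hi) (by simpa using hj)).1 h
  · intro y hy
    simpa [sameCycle_iff_exists_iterate] using hy
  · intros; rfl

theorem Equiv.Perm.card_sameCycle {P : Type*} [Fintype P] [DecidableEq P] (T : Equiv.Perm P)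
    (x : P) :
    (Finset.univ.filter fun y => T.SameCycle x y).card = minimalPeriod T x := by
  have h := prod_sameCycle T x (fun _ => Multiplicative.ofAdd 1)
  rw [Finset.prod_const, Finset.prod_const, Finset.card_range] at h
  simpa [← ofAdd_nsmul] using h

theorem Equiv.Perm.SameCycle.minimalPeriod_eq {P : Type*} {T : Equiv.Perm P} {x y : P}
    (h : T.SameCycle x y) : minimalPeriod T x = minimalPeriod T y := by
  obtain ⟨i, rfl⟩ := h
  apply Nat.dvd_right_iff_eq.1
  intro n
  rw [← isPeriodicPt_iff_minimalPeriod_dvd, ← isPeriodicPt_iff_minimalPeriod_dvd, IsPeriodicPt,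
    IsPeriodicPt, IsFixedPt, IsFixedPt, Equiv.Perm.iterate_eq_pow, ← Equiv.Perm.mul_apply,
    ← zpow_natCast, (Commute.zpow_zpow_self T n i).eq, Equiv.Perm.mul_apply]
  simp

/-! ### Counting equivariant maps -/

/-- Makes the prescription `T^[i] r ↦ U^[i] y` well defined, so that a value at a cycle
representative extends along its cycle. -/
theorem iterate_eq_of_isPeriodicPt {P Y : Type*} {T : P → P} {U : Y → Y} {r : P} {y : Y}
    (h : IsPeriodicPt U (minimalPeriod T r) y) (hr : 0 < minimalPeriod T r) {i j : ℕ}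
    (hij : T^[i] r = T^[j] r) : U^[i] y = U^[j] y := by
  rw [← iterate_mod_minimalPeriod_eq (n := i), ← iterate_mod_minimalPeriod_eq (n := j),
    iterate_eq_iterate_iff_of_lt_minimalPeriod (Nat.mod_lt _ hr) (Nat.mod_lt _ hr)] at hij
  rw [← h.iterate_mod_apply i, ← h.iterate_mod_apply j, hij]

/-- An equivariant map is freely determined by its values at representatives of the cycles. -/
theorem card_equivariant_eq_prod_quotient {P Y : Type*} [Finite P] (T : Equiv.Perm P)
    (U : Y → Y) [Fintype (Quotient (SameCycle.setoid T))] :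
    Nat.card {f : P → Y // ∀ x, f (T x) = U (f x)} =
      ∏ o : Quotient (SameCycle.setoid T),
        Nat.card {y : Y // IsPeriodicPt U (minimalPeriod T o.out) y} := by
  rw [← Nat.card_pi]
  have iter : ∀ (f : P → Y), (∀ x, f (T x) = U (f x)) → ∀ i x, f (T^[i] x) = U^[i] (f x) := by
    intro f hf i x
    exact (Semiconj.iterate_right (f := f) (fun x => hf x) i) x
  have rep : ∀ x : P, ∃ i, T^[i] (Quotient.mk (SameCycle.setoid T) x).out = x := by
    intro x
    have h : T.SameCycle (Quotient.mk (SameCycle.setoid T) x).out x :=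
      Quotient.mk_out (s := SameCycle.setoid T) x
    obtain ⟨i, -, hi⟩ := (sameCycle_iff_exists_iterate T _ _).1 h
    exact ⟨i, hi⟩
  choose ind hind using rep
  apply Nat.card_congr
  refine Equiv.ofBijective (fun f o => ⟨f.1 o.out, ?_⟩) ⟨?_, ?_⟩
  · show U^[_] _ = _
    rw [← iter f.1 f.2, iterate_minimalPeriod]
  · intro f g h
    ext x
    rw [← hind x, iter f.1 f.2, iter g.1 g.2]
    have := congrArg Subtype.val (congrFun h (Quotient.mk (SameCycle.setoid T) x))
    simp only at this
    rw [this]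
  · intro g
    -- The chosen exponent `ind x` is arbitrary, and need not be 0 at a representative; any other
    -- exponent reaching `x` yields the same value.
    have key : ∀ (x : P) (o : Quotient (SameCycle.setoid T)) (i j : ℕ),
        T^[i] o.out = x → T^[j] o.out = x → U^[i] (g o).1 = U^[j] (g o).1 := by
      intro x o i j hi hj
      exact iterate_eq_of_isPeriodicPt (g o).2 (T.minimalPeriod_pos _) (hi.trans hj.symm)
    refine ⟨⟨fun x => U^[ind x] (g (Quotient.mk (SameCycle.setoid T) x)).1, ?_⟩, ?_⟩
    · intro x
      have e : Quotient.mk (SameCycle.setoid T) (T x) = Quotient.mk (SameCycle.setoid T) x :=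
        Quotient.sound (s := SameCycle.setoid T) (sameCycle_apply_left.2 (SameCycle.refl T x))
      have h1 := hind (T x)
      rw [e] at h1
      beta_reduce
      rw [e, ← iterate_succ_apply' U]
      refine key (T x) _ _ _ h1 ?_
      rw [iterate_succ_apply', hind x]
    · funext o
      apply Subtype.ext
      have e : Quotient.mk (SameCycle.setoid T) o.out = o := Quotient.out_eq o
      have h1 := hind o.out
      show U^[ind o.out] (g (Quotient.mk (SameCycle.setoid T) o.out)).1 = _
      rw [e] at h1 ⊢
      exact key o.out o _ 0 h1 rfl

/-- The number of equivariant maps, as a product over all points of the domain. -/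
theorem card_equivariant_eq_prod_rpow {P Y : Type*} [Fintype P] [Finite Y] (T : Equiv.Perm P)
    (U : Y → Y) :
    (Nat.card {f : P → Y // ∀ x, f (T x) = U (f x)} : ℝ) =
      ∏ x : P, (Nat.card {y : Y // IsPeriodicPt U (minimalPeriod T x) y} : ℝ) ^
        ((minimalPeriod T x : ℝ)⁻¹) := by
  classical
  rw [card_equivariant_eq_prod_quotient, Nat.cast_prod,
    ← Finset.prod_fiberwise_of_maps_to (s := Finset.univ) (t := Finset.univ)
      (g := fun x => Quotient.mk (SameCycle.setoid T) x) (by simp)]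
  refine Finset.prod_congr rfl fun o _ => ?_
  have hset : (Finset.univ.filter fun x => Quotient.mk (SameCycle.setoid T) x = o) =
      Finset.univ.filter fun x => T.SameCycle o.out x := by
    ext x
    simp only [Finset.mem_filter, Finset.mem_univ, true_and]
    rw [eq_comm, ← Quotient.out_eq o, Quotient.eq (r := SameCycle.setoid T)]
    simp only [Quotient.out_eq]
    rfl
  rw [hset, Finset.prod_congr rfl (g := fun _ =>
    (Nat.card {y : Y // IsPeriodicPt U (minimalPeriod T o.out) y} : ℝ) ^
        ((minimalPeriod T o.out : ℝ)⁻¹))]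
  -- The cycle has as many points as its length, so the equal roots multiply back to its factor.
  · rw [prod_sameCycle, Finset.prod_const, Finset.card_range, ← Real.rpow_natCast,
      ← Real.rpow_mul (by positivity), inv_mul_cancel₀, Real.rpow_one]
    exact_mod_cast (T.minimalPeriod_pos _).ne'
  · intro x hx
    rw [(Finset.mem_filter.1 hx).2.minimalPeriod_eq]

/-! ### Partitions and conjugacy classes of permutations -/

theorem Equiv.Perm.minimalPeriod_eq_card_support_cycleOf {α : Type*} [Fintype α] [DecidableEq α]
    (σ : Equiv.Perm α) {x : α} (hx : x ∈ σ.support) :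
    minimalPeriod σ x = (σ.cycleOf x).support.card := by
  rw [← card_sameCycle]
  congr 1
  ext y
  rw [mem_support_cycleOf_iff, Finset.mem_filter]
  simp only [hx, Finset.mem_univ, true_and, and_true]

/-- The points of period `d` fill the cycles of length `d`. Since `cycleType` omits fixed points,
the case `d = 1` is read off from the ones that `partition` adds. -/
theorem Equiv.Perm.card_minimalPeriod_eq {α : Type*} [Fintype α] [DecidableEq α]
    (σ : Equiv.Perm α) (d : ℕ) :
    (Finset.univ.filter fun x => minimalPeriod σ x = d).card = d * σ.partition.mult d := by
  rw [Nat.Partition.mult, parts_partition, Multiset.count_add]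
  rcases Nat.lt_or_ge d 2 with hd | hd
  · have h0 : σ.cycleType.count d = 0 := by
      rw [Multiset.count_eq_zero]
      intro h
      have := two_le_of_mem_cycleType h
      omega
    interval_cases d
    · simp [(σ.minimalPeriod_pos _).ne']
    · rw [h0, Multiset.count_replicate_self, ← Finset.card_compl]
      simp only [minimalPeriod_eq_one_iff_isFixedPt, zero_add, one_mul]
      congr 1
      ext x
      rw [Finset.mem_filter, Finset.mem_compl, mem_support, not_not]
      simp [IsFixedPt]
  · rw [Multiset.count_replicate, if_neg (by omega), add_zero, cycleType_def, Multiset.count_map]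
    rw [Finset.card_eq_sum_card_fiberwise (f := σ.cycleOf)
      (t := σ.cycleFactorsFinset.filter fun c => d = c.support.card)]
    · have hcard : ∀ c ∈ σ.cycleFactorsFinset.filter (fun c => d = c.support.card),
          ((Finset.univ.filter fun x => minimalPeriod σ x = d).filter
            fun x => σ.cycleOf x = c).card = d := by
        intro c hc
        obtain ⟨hc, hcd⟩ := Finset.mem_filter.1 hc
        have : ((Finset.univ.filter fun x => minimalPeriod σ x = d).filter
            fun x => σ.cycleOf x = c) = c.support := by
          ext x
          simp only [Finset.mem_filter, Finset.mem_univ, true_and]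
          constructor
          · rintro ⟨hx, rfl⟩
            rw [cycleOf_mem_cycleFactorsFinset_iff] at hc
            rw [mem_support_cycleOf_iff]
            exact ⟨SameCycle.refl _ _, hc⟩
          · intro hx
            have e := cycle_is_cycleOf hx hc
            refine ⟨?_, e.symm⟩
            rw [minimalPeriod_eq_card_support_cycleOf, ← e, hcd]
            exact mem_cycleFactorsFinset_support_le hc hx
        rw [this, ← hcd]
      rw [Finset.sum_congr rfl hcard, Finset.sum_const, smul_eq_mul, mul_comm]
      rfl
    · intro x hx
      have hx' : minimalPeriod σ x = d := by simpa using hx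
      have hs : x ∈ σ.support := by
        rw [mem_support]
        intro h
        rw [minimalPeriod_eq_one_iff_isFixedPt.2 h] at hx'
        omega
      have := minimalPeriod_eq_card_support_cycleOf σ hs
      simp [cycleOf_mem_cycleFactorsFinset_iff, ← this, hx', mem_support.1 hs]

theorem Nat.Partition.parts_eq_filter_add_replicate {n : ℕ} (k : n.Partition) :
    k.parts = k.parts.filter (fun i => 2 ≤ i) + Multiset.replicate (k.mult 1) 1 := by
  conv_lhs => rw [← Multiset.filter_add_not (fun i => 2 ≤ i) k.parts]
  congr 1
  rw [Nat.Partition.mult, ← Multiset.filter_eq']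
  apply Multiset.filter_congr
  intro i hi
  have := k.parts_pos hi
  omega

theorem Nat.Partition.sum_filter_add_mult_one {n : ℕ} (k : n.Partition) :
    (k.parts.filter (fun i => 2 ≤ i)).sum + k.mult 1 = n := by
  have := k.parts_sum
  rw [k.parts_eq_filter_add_replicate] at this
  simpa using this

theorem Equiv.Perm.partition_eq_iff {α : Type*} [Fintype α] [DecidableEq α]
    (σ : Equiv.Perm α) (k : (Fintype.card α).Partition) :
    σ.partition = k ↔ σ.cycleType = k.parts.filter (fun i => 2 ≤ i) := by
  constructor
  · rintro rfl
    rw [filter_parts_partition_eq_cycleType]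
  · intro h
    apply Nat.Partition.ext
    have := k.sum_filter_add_mult_one
    rw [parts_partition, ← sum_cycleType, h]
    conv_rhs => rw [k.parts_eq_filter_add_replicate]
    congr 2
    omega

theorem Nat.Partition.centralizerOrder_eq {n : ℕ} (k : n.Partition) :
    k.centralizerOrder = (n - (k.parts.filter (fun i => 2 ≤ i)).sum).factorial *
      (k.parts.filter (fun i => 2 ≤ i)).prod *
      ∏ i ∈ (k.parts.filter (fun i => 2 ≤ i)).toFinset,
        ((k.parts.filter (fun i => 2 ≤ i)).count i).factorial := by
  have h1 : n - (k.parts.filter (fun i => 2 ≤ i)).sum = k.mult 1 := by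
    have := k.sum_filter_add_mult_one
    omega
  have hone : ∀ i, i ∉ k.parts.toFinset → (k.mult i).factorial * i ^ k.mult i = 1 := by
    intro i hi
    have : k.mult i = 0 := Multiset.count_eq_zero.2 (by simpa using hi)
    simp [this]
  rw [centralizerOrder, h1, Finset.prod_multiset_count, mul_assoc, ← Finset.prod_mul_distrib]
  rw [← Finset.prod_subset (s₁ := k.parts.toFinset) _ fun i _ hi => hone i hi]
  -- The summands 1 are split off: they contribute only `(k.mult 1)!`, the leading factorial.
  · rw [Finset.prod_subset (s₂ := insert 1 (k.parts.filter (fun i => 2 ≤ i)).toFinset) _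
      fun i _ hi => hone i hi]
    · rw [Finset.prod_insert (by simp)]
      simp only [one_pow, mul_one]
      congr 1
      refine Finset.prod_congr rfl fun i hi => ?_
      have hi2 : 2 ≤ i := by
        simp only [Multiset.mem_toFinset, Multiset.mem_filter] at hi
        exact hi.2
      rw [Multiset.count_filter_of_pos hi2, mul_comm]
      rfl
    · intro i hi
      have := k.parts_pos (Multiset.mem_toFinset.1 hi)
      simp only [Multiset.mem_toFinset] at hi
      simp only [Finset.mem_insert, Multiset.mem_toFinset, Multiset.mem_filter, hi, true_and]
      omega
  · intro i hi
    rw [Multiset.mem_toFinset] at hi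
    exact Finset.mem_Icc.2 ⟨k.parts_pos hi, Nat.Partition.le_of_mem_parts hi⟩

theorem Nat.Partition.centralizerOrder_pos {n : ℕ} (k : n.Partition) :
    0 < k.centralizerOrder :=
  Finset.prod_pos fun _ hi =>
    Nat.mul_pos (Nat.factorial_pos _) (Nat.pow_pos (Finset.mem_Icc.1 hi).1)

theorem Equiv.Perm.card_partition_eq_mul {α : Type*} [Fintype α] [DecidableEq α]
    (k : (Fintype.card α).Partition) :
    (Finset.univ.filter fun σ : Equiv.Perm α => σ.partition = k).card * k.centralizerOrder =
      (Fintype.card α).factorial := by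
  have h := card_of_cycleType_mul_eq α (k.parts.filter (fun i => 2 ≤ i))
  rw [if_pos] at h
  · rw [← h, k.centralizerOrder_eq]
    congr 3
    ext σ
    rw [partition_eq_iff]
  · have := k.sum_filter_add_mult_one
    exact ⟨by omega, fun a ha => (Multiset.mem_filter.1 ha).2⟩

/-- Turns a Burnside sum into a sum over partitions: the class of `k` has `n! / k.centralizerOrder`
elements. -/
theorem Equiv.Perm.sum_partition {α : Type*} [Fintype α] [DecidableEq α]
    (F : (Fintype.card α).Partition → ℝ) :
    ∑ σ : Equiv.Perm α, F σ.partition =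
      (Fintype.card α).factorial * ∑ k, (k.centralizerOrder : ℝ)⁻¹ * F k := by
  rw [← Finset.sum_fiberwise (s := Finset.univ) (g := fun σ : Equiv.Perm α => σ.partition),
    Finset.mul_sum]
  refine Finset.sum_congr rfl fun k _ => ?_
  rw [Finset.sum_congr rfl (g := fun _ => F k) fun σ hσ => by rw [(Finset.mem_filter.1 hσ).2],
    Finset.sum_const, nsmul_eq_mul, ← card_partition_eq_mul k]
  have := k.centralizerOrder_pos
  push_cast
  field_simp

/-! ### Equivariant maps in terms of cycle lengths -/

theorem Equiv.Perm.prod_minimalPeriod {α M : Type*} [Fintype α] [DecidableEq α] [CommMonoid M]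
    (σ : Equiv.Perm α) (g : ℕ → M) :
    ∏ x, g (minimalPeriod σ x) =
      ∏ a ∈ Finset.Icc 1 (Fintype.card α), g a ^ (a * σ.partition.mult a) := by
  rw [← Finset.prod_fiberwise_of_maps_to (t := Finset.Icc 1 (Fintype.card α))
    (g := fun x => minimalPeriod σ x)]
  · refine Finset.prod_congr rfl fun a _ => ?_
    rw [Finset.prod_congr rfl (g := fun _ => g a) fun x hx => by rw [(Finset.mem_filter.1 hx).2],
      Finset.prod_const, card_minimalPeriod_eq]
  · intro x _
    exact Finset.mem_Icc.2 ⟨σ.minimalPeriod_pos x, by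
      rw [← card_sameCycle]
      exact Finset.card_le_univ _⟩

/-- The number of fixed points of the `l`-th power of a permutation extended by a fixed point. -/
theorem Equiv.Perm.card_isPeriodicPt_optionCongr {β : Type*} [Fintype β] [DecidableEq β]
    (τ : Equiv.Perm β) {l : ℕ} (hl : 0 < l) :
    Nat.card {y : Option β // IsPeriodicPt (Option.map τ) l y} = τ.partition.divisorTerm l := by
  classical
  -- A point is fixed by the `l`-th iterate exactly when its cycle length divides `l`; the adjoined
  -- point accounts for the 1 in `divisorTerm`.
  have hsome : ∀ y : β, IsPeriodicPt (Option.map τ) l (some y) ↔ minimalPeriod τ y ∣ l := by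
    intro y
    have h : (Option.map τ)^[l] (some y) = some (τ^[l] y) :=
      ((show Semiconj some τ (Option.map τ) from fun x => rfl).iterate_right l y).symm
    rw [← isPeriodicPt_iff_minimalPeriod_dvd, IsPeriodicPt, IsFixedPt, h, Option.some_inj]
    rfl
  have hnone : IsPeriodicPt (Option.map τ) l none := by
    exact IsFixedPt.iterate (show IsFixedPt (Option.map τ) none from rfl) l
  rw [Nat.card_eq_fintype_card, Fintype.card_subtype, Finset.card_filter, Fintype.sum_option,
    if_pos hnone, Nat.Partition.divisorTerm]
  congr 1
  simp only [hsome]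
  rw [← Finset.card_filter, Finset.card_eq_sum_card_fiberwise (f := fun x => minimalPeriod τ x)
    (t := l.divisors)]
  · refine Finset.sum_congr rfl fun d hd => ?_
    rw [← card_minimalPeriod_eq, Finset.filter_filter]
    congr 1
    ext x
    simp only [Finset.mem_filter, Finset.mem_univ, true_and, and_iff_right_iff_imp]
    rintro rfl
    exact Nat.dvd_of_mem_divisors hd
  · intro x hx
    simpa [hl.ne'] using hx

/-- The contribution to the number of equivariant maps of one point of a cycle of length `l`. -/
noncomputable def pointWeight {n : ℕ} (j : n.Partition) (l : ℕ) : ℝ :=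
  (j.divisorTerm l : ℝ) ^ ((l : ℝ)⁻¹)

theorem Nat.Partition.divisorTerm_pos {n : ℕ} (j : n.Partition) (l : ℕ) :
    (0 : ℝ) < j.divisorTerm l := by
  rw [Nat.Partition.divisorTerm]
  positivity

theorem pointWeight_pos {n : ℕ} (j : n.Partition) (l : ℕ) : 0 < pointWeight j l :=
  Real.rpow_pos_of_pos (j.divisorTerm_pos l) _

theorem pointWeight_pow {n : ℕ} (j : n.Partition) {l : ℕ} (hl : 0 < l) (c : ℕ) :
    pointWeight j l ^ (l * c) = (j.divisorTerm l : ℝ) ^ c := by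
  rw [pointWeight, ← Real.rpow_natCast, ← Real.rpow_mul (j.divisorTerm_pos l).le,
    ← Real.rpow_natCast]
  congr 1
  push_cast
  field_simp

theorem card_equivariant_option_eq_prod {P B : Type*} [Fintype P] [Fintype B] [DecidableEq B]
    (T : Equiv.Perm P) (τ : Equiv.Perm B) :
    (Nat.card {f : P → Option B // ∀ x, f (T x) = Option.map τ (f x)} : ℝ) =
      ∏ x : P, pointWeight τ.partition (minimalPeriod T x) := by
  rw [card_equivariant_eq_prod_rpow]
  refine Finset.prod_congr rfl fun x _ => ?_
  rw [card_isPeriodicPt_optionCongr τ (T.minimalPeriod_pos x), pointWeight]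

/-- There are `a k_a · b k_b` pairs with coordinate periods `a` and `b`, each of period `lcm(a, b)`;
since `ab = gcd · lcm`, the roots combine to the exponent `k_a k_b gcd(a, b)`. -/
theorem card_equivariant_prodCongr {A B : Type*} [Fintype A] [DecidableEq A] [Fintype B]
    [DecidableEq B] (σ : Equiv.Perm A) (τ : Equiv.Perm B) :
    (Nat.card {f : A × A → Option B //
        ∀ x, f (Equiv.prodCongr σ σ x) = Option.map τ (f x)} : ℝ) =
      ∏ a ∈ Finset.Icc 1 (Fintype.card A), ∏ b ∈ Finset.Icc 1 (Fintype.card A),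
        (τ.partition.divisorTerm (Nat.lcm a b) : ℝ) ^
          (σ.partition.mult a * σ.partition.mult b * Nat.gcd a b) := by
  have hper : ∀ x : A × A, minimalPeriod (Equiv.prodCongr σ σ) x =
      (minimalPeriod σ x.1).lcm (minimalPeriod σ x.2) := fun x => minimalPeriod_prodMap _ _ _
  rw [card_equivariant_option_eq_prod, Fintype.prod_prod_type]
  simp only [hper]
  rw [prod_minimalPeriod σ fun a => ∏ y, pointWeight τ.partition (a.lcm (minimalPeriod σ y))]
  refine Finset.prod_congr rfl fun a ha => ?_
  rw [prod_minimalPeriod σ fun b => pointWeight τ.partition (a.lcm b), ← Finset.prod_pow]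
  refine Finset.prod_congr rfl fun b hb => ?_
  have ha' := (Finset.mem_Icc.1 ha).1
  have hb' := (Finset.mem_Icc.1 hb).1
  rw [← pointWeight_pow _ (Nat.lcm_pos ha' hb'), ← pow_mul]
  congr 1
  have := Nat.gcd_mul_lcm a b
  calc _ = (a * b) * (σ.partition.mult a * σ.partition.mult b) := by ring
    _ = _ := by rw [← this]; ring

/-! ### Fixed tables under transposition: the factors `p_{a,b}` and `q_a` -/

/-- The permutation `(x, y) ↦ (σ y, σ x)`. -/
def twist {A : Type*} (σ : Equiv.Perm A) : Equiv.Perm (A × A) :=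
  (Equiv.prodCongr σ σ).trans (Equiv.prodComm A A)

theorem twist_iterate {A : Type*} (σ : Equiv.Perm A) (l : ℕ) (x y : A) :
    (twist σ)^[l] (x, y) = if Even l then (σ^[l] x, σ^[l] y) else (σ^[l] y, σ^[l] x) := by
  induction l with
  | zero => simp
  | succ l ih =>
    rw [iterate_succ_apply', ih]
    by_cases h : Even l
    · simp [h, Nat.even_add_one, iterate_succ_apply', twist, -iterate_succ]
    · simp [h, Nat.even_add_one, iterate_succ_apply', twist, -iterate_succ]

theorem isPeriodicPt_twist_iff {A : Type*} (σ : Equiv.Perm A) (l : ℕ) (x y : A) :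
    IsPeriodicPt (twist σ) l (x, y) ↔
      (Even l ∧ IsPeriodicPt σ l x ∧ IsPeriodicPt σ l y) ∨
      (¬ Even l ∧ σ^[l] y = x ∧ σ^[l] x = y) := by
  rw [IsPeriodicPt, IsFixedPt, twist_iterate]
  by_cases h : Even l <;> simp [h, IsPeriodicPt, IsFixedPt]

/-- An odd iterate exchanges the coordinates, so it can fix a pair only if both lie on one cycle. -/
theorem minimalPeriod_twist_of_not_sameCycle {A : Type*} (σ : Equiv.Perm A)
    {x y : A} (h : ¬ σ.SameCycle x y) :
    minimalPeriod (twist σ) (x, y) =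
      Nat.lcm 2 (Nat.lcm (minimalPeriod σ x) (minimalPeriod σ y)) := by
  apply Nat.dvd_right_iff_eq.1
  intro l
  rw [← isPeriodicPt_iff_minimalPeriod_dvd, isPeriodicPt_twist_iff, Nat.lcm_dvd_iff,
    Nat.lcm_dvd_iff, ← isPeriodicPt_iff_minimalPeriod_dvd, ← isPeriodicPt_iff_minimalPeriod_dvd,
    even_iff_two_dvd]
  constructor
  · rintro (h' | ⟨-, -, rfl⟩)
    · exact h'
    · exact absurd (by rw [Equiv.Perm.iterate_eq_pow, sameCycle_pow_right]) h
  · exact Or.inl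

theorem isPeriodicPt_twist_iterate_iff {A : Type*} [Finite A] (σ : Equiv.Perm A) (l i : ℕ)
    (x : A) :
    IsPeriodicPt (twist σ) l (x, σ^[i] x) ↔
      (Even l ∧ minimalPeriod σ x ∣ l) ∨
      (¬ Even l ∧ minimalPeriod σ x ∣ l + i ∧ l ≡ i [MOD minimalPeriod σ x]) := by
  rw [isPeriodicPt_twist_iff]
  have h1 : σ.SameCycle x (σ^[i] x) := by rw [Equiv.Perm.iterate_eq_pow, sameCycle_pow_right]
  have h2 : σ^[l] x = σ^[i] x ↔ l ≡ i [MOD minimalPeriod σ x] := by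
    rw [← iterate_mod_minimalPeriod_eq (n := l), ← iterate_mod_minimalPeriod_eq (n := i),
      iterate_eq_iterate_iff_of_lt_minimalPeriod (Nat.mod_lt _ (σ.minimalPeriod_pos x))
        (Nat.mod_lt _ (σ.minimalPeriod_pos x))]
    rfl
  rw [isPeriodicPt_iff_minimalPeriod_dvd, isPeriodicPt_iff_minimalPeriod_dvd,
    ← h1.minimalPeriod_eq, ← iterate_add_apply, h2, ← isPeriodicPt_iff_minimalPeriod_dvd,
    ← isPeriodicPt_iff_minimalPeriod_dvd, and_self]
  rfl

/-- An odd return of `(x, σ^i x)` thus forces `2i ≡ 0` modulo the cycle length `a`. Only `i = 0` and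
`i = a/2` can be exceptional, whence the three cases of `q_a`. -/
theorem dvd_two_mul_of_dvd_add_of_modEq {a l i : ℕ} (h : a ∣ l + i) (h' : l ≡ i [MOD a]) :
    a ∣ 2 * i := by
  rw [two_mul]
  exact (Nat.modEq_zero_iff_dvd.1 ((h'.symm.add_right i).trans (Nat.modEq_zero_iff_dvd.2 h)))

theorem minimalPeriod_twist_of_odd {A : Type*} [Finite A] (σ : Equiv.Perm A) (x : A)
    (ha : Odd (minimalPeriod σ x)) {i : ℕ} (hi : i < minimalPeriod σ x) :
    minimalPeriod (twist σ) (x, σ^[i] x) =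
      if i = 0 then minimalPeriod σ x else 2 * minimalPeriod σ x := by
  apply Nat.dvd_right_iff_eq.1
  intro l
  rw [← isPeriodicPt_iff_minimalPeriod_dvd, isPeriodicPt_twist_iterate_iff]
  generalize minimalPeriod σ x = a at *
  split_ifs with h0
  · subst h0
    rw [Nat.modEq_zero_iff_dvd, add_zero]
    tauto
  · have hco : Nat.Coprime a 2 := Nat.coprime_two_right.2 ha
    have hmul : 2 * a ∣ l ↔ 2 ∣ l ∧ a ∣ l :=
      ⟨fun h => ⟨(Dvd.intro _ rfl).trans h, (Dvd.intro_left _ rfl).trans h⟩,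
        fun h => hco.symm.mul_dvd_of_dvd_of_dvd h.1 h.2⟩
    rw [hmul, even_iff_two_dvd]
    constructor
    · rintro (h | ⟨-, h, h'⟩)
      · exact h
      · exact absurd (Nat.le_of_dvd (Nat.pos_of_ne_zero h0)
          (hco.dvd_of_dvd_mul_left (dvd_two_mul_of_dvd_add_of_modEq h h'))) (by omega)
    · exact Or.inl

/-- No odd return exists: `4 ∣ 2i` makes `i` even, and then `4 ∣ l + i` makes `l` even. -/
theorem minimalPeriod_twist_of_four_dvd {A : Type*} [Finite A] (σ : Equiv.Perm A) (x : A)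
    (ha : 4 ∣ minimalPeriod σ x) (i : ℕ) :
    minimalPeriod (twist σ) (x, σ^[i] x) = minimalPeriod σ x := by
  apply Nat.dvd_right_iff_eq.1
  intro l
  rw [← isPeriodicPt_iff_minimalPeriod_dvd, isPeriodicPt_twist_iterate_iff]
  generalize minimalPeriod σ x = a at *
  constructor
  · rintro (h | ⟨hl, h, h'⟩)
    · exact h.2
    · have h1 := ha.trans (dvd_two_mul_of_dvd_add_of_modEq h h')
      have h2 : (4 : ℕ) ∣ l + i := ha.trans h
      exact absurd (even_iff_two_dvd.2 (by omega)) hl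
  · intro h
    exact Or.inl ⟨even_iff_two_dvd.2 ((show 2 ∣ a by omega).trans h), h⟩

theorem minimalPeriod_twist_of_two_mul_odd {A : Type*} [Finite A] (σ : Equiv.Perm A) (x : A)
    {c : ℕ} (hc : Odd c) (ha : minimalPeriod σ x = 2 * c) {i : ℕ}
    (hi : i < minimalPeriod σ x) :
    minimalPeriod (twist σ) (x, σ^[i] x) = if i = c then c else minimalPeriod σ x := by
  apply Nat.dvd_right_iff_eq.1
  intro l
  rw [← isPeriodicPt_iff_minimalPeriod_dvd, isPeriodicPt_twist_iterate_iff]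
  rw [ha] at *
  have hco : Nat.Coprime 2 c := Nat.coprime_two_left.2 hc
  split_ifs with h0
  · subst h0
    constructor
    · rintro (h | ⟨-, h, -⟩)
      · exact (Dvd.intro_left _ rfl).trans h.2
      · exact (Nat.dvd_add_left (dvd_refl _)).1 ((Dvd.intro_left _ rfl).trans h)
    · intro h
      by_cases hl : Even l
      · exact Or.inl ⟨hl, hco.mul_dvd_of_dvd_of_dvd (even_iff_two_dvd.1 hl) h⟩
      · refine Or.inr ⟨hl, ?_, ?_⟩
        · exact hco.mul_dvd_of_dvd_of_dvd
            (even_iff_two_dvd.1 ((Nat.not_even_iff_odd.1 hl).add_odd hc))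
            ((Nat.dvd_add_left (dvd_refl _)).2 h)
        · rw [← Nat.modEq_and_modEq_iff_modEq_mul hco]
          constructor
          · rw [Nat.ModEq, Nat.odd_iff.1 hc, Nat.odd_iff.1 (Nat.not_even_iff_odd.1 hl)]
          · rw [Nat.ModEq, Nat.mod_self, Nat.mod_eq_zero_of_dvd h]
  · constructor
    · rintro (h | ⟨hl, h, h'⟩)
      · exact h.2
      · exfalso
        have h1 : c ∣ i := Nat.dvd_of_mul_dvd_mul_left two_pos
          (dvd_two_mul_of_dvd_add_of_modEq h h')
        -- As `i = ct < 2c`, only `t = 0` and `t = 1` remain; the first makes `l` even and the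
        -- second is the excluded `i = c`.
        obtain ⟨t, rfl⟩ := h1
        have hc' : 0 < c := hc.pos
        have ht : t < 2 := by nlinarith
        interval_cases t
        · exact hl (even_iff_two_dvd.2 ((Dvd.intro _ rfl).trans (by simpa using h)))
        · simp at h0
    · intro h
      exact Or.inl ⟨even_iff_two_dvd.2 ((Dvd.intro _ rfl).trans h), h⟩

theorem Finset.prod_range_ite_eq {M : Type*} [CommMonoid M] {a c : ℕ} (hc : c < a) (u v : M) :
    ∏ i ∈ Finset.range a, (if i = c then u else v) = u * v ^ (a - 1) := by
  rw [← Finset.mul_prod_erase _ _ (Finset.mem_range.2 hc), if_pos rfl,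
    Finset.prod_congr rfl (g := fun _ => v) fun i hi => if_neg (Finset.ne_of_mem_erase hi),
    Finset.prod_const, Finset.card_erase_of_mem (Finset.mem_range.2 hc), Finset.card_range]

/-- The row product depends only on the length `a` of the cycle, so its `a`-th power is the
contribution of all `a²` pairs on that cycle. -/
theorem prod_pointWeight_twist_sameCycle {A : Type*} [Finite A] {n : ℕ} (j : n.Partition)
    (σ : Equiv.Perm A) (x : A) :
    (∏ i ∈ Finset.range (minimalPeriod σ x),
      pointWeight j (minimalPeriod (twist σ) (x, σ^[i] x))) ^ minimalPeriod σ x =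
      factorQ j (minimalPeriod σ x) := by
  have hpos := σ.minimalPeriod_pos x
  rw [factorQ]
  split_ifs with h2 h4
  · rw [Finset.prod_congr rfl (g := fun i => if i = 0 then pointWeight j (minimalPeriod σ x) else
        pointWeight j (2 * minimalPeriod σ x)), Finset.prod_range_ite_eq hpos, mul_pow, ← pow_mul]
    · congr 1
      · simpa using pointWeight_pow j hpos 1
      · rw [← pointWeight_pow j (by omega)]
        congr 1
        obtain ⟨c, hc⟩ := Nat.odd_iff.2 h2
        rw [hc, show (2 * c + 1 - 1) = 2 * c by omega, show 2 * c / 2 = c by omega]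
        ring
    · intro i hi
      rw [minimalPeriod_twist_of_odd σ x (Nat.odd_iff.2 h2) (Finset.mem_range.1 hi)]
      split_ifs <;> rfl
  · simp only [minimalPeriod_twist_of_four_dvd σ x (Nat.dvd_of_mod_eq_zero h4)]
    rw [Finset.prod_const, Finset.card_range, ← pow_mul, pointWeight_pow j hpos]
  · obtain ⟨c, hc⟩ : ∃ c, minimalPeriod σ x = 2 * c := ⟨minimalPeriod σ x / 2, by omega⟩
    have hodd : Odd c := Nat.odd_iff.2 (by omega)
    rw [Finset.prod_congr rfl (g := fun i => if i = c then pointWeight j c else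
        pointWeight j (minimalPeriod σ x)), Finset.prod_range_ite_eq (c := c) (by omega), mul_pow,
        ← pow_mul]
    · congr 1
      · rw [show minimalPeriod σ x / 2 = c by omega, ← pointWeight_pow j hodd.pos, hc, mul_comm]
      · rw [mul_comm (_ - 1), pointWeight_pow j hpos]
    · intro i hi
      rw [minimalPeriod_twist_of_two_mul_odd σ x hodd hc (Finset.mem_range.1 hi)]
      split_ifs <;> rfl

/-- `p_{a,b}` is the weight of the `ab` pairs in `C × D` for distinct cycles `C`, `D`. The twist
exchanges `C × D` with `D × C`, so each block carries half of the cycles; hence the possible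
half-integer exponent. -/
theorem factorP_eq_pointWeight_pow {n : ℕ} (j : n.Partition) (a b : ℕ) :
    factorP j a b = pointWeight j (Nat.lcm 2 (Nat.lcm a b)) ^ (a * b) := by
  rw [factorP, pointWeight, ← Real.rpow_natCast, ← Real.rpow_mul (j.divisorTerm_pos _).le]
  congr 1
  push_cast
  ring

theorem factorP_comm {n : ℕ} (j : n.Partition) (a b : ℕ) : factorP j a b = factorP j b a := by
  rw [factorP, factorP, Nat.lcm_comm a b, mul_comm (a : ℝ)]

theorem factorP_pos {n : ℕ} (j : n.Partition) (a b : ℕ) : 0 < factorP j a b := by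
  rw [factorP_eq_pointWeight_pow]
  exact pow_pos (pointWeight_pos _ _) _

/-- The last product treats every `y` as lying off the cycle of `x`; the inverse removes that false
weight for the points on the cycle, and the root of `q_a` supplies the true one. -/
theorem prod_pointWeight_twist {A : Type*} [Fintype A] [DecidableEq A] {n : ℕ} (j : n.Partition)
    (σ : Equiv.Perm A) (x : A) :
    ∏ y, pointWeight j (minimalPeriod (twist σ) (x, y)) =
      factorQ j (minimalPeriod σ x) ^ ((minimalPeriod σ x : ℝ)⁻¹) *
        (pointWeight j (Nat.lcm 2 (Nat.lcm (minimalPeriod σ x) (minimalPeriod σ x))) ^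
          minimalPeriod σ x)⁻¹ *
        ∏ b ∈ Finset.Icc 1 (Fintype.card A),
          pointWeight j (Nat.lcm 2 (Nat.lcm (minimalPeriod σ x) b)) ^
            (b * σ.partition.mult b) := by
  set a := minimalPeriod σ x with ha
  have hpos : 0 < a := σ.minimalPeriod_pos x
  set w : A → ℝ := fun y => pointWeight j (Nat.lcm 2 (Nat.lcm a (minimalPeriod σ y))) with hw
  rw [← prod_minimalPeriod σ fun b => pointWeight j (Nat.lcm 2 (Nat.lcm a b))]
  rw [← Finset.prod_filter_mul_prod_filter_not _ (fun y => σ.SameCycle x y),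
    ← Finset.prod_filter_mul_prod_filter_not _ (fun y => σ.SameCycle x y) w]
  have h1 : ∏ y with σ.SameCycle x y, w y =
      pointWeight j (Nat.lcm 2 (Nat.lcm a a)) ^ a := by
    rw [Finset.prod_congr rfl (g := fun _ => pointWeight j (Nat.lcm 2 (Nat.lcm a a))),
      Finset.prod_const, card_sameCycle]
    intro y hy
    rw [hw]
    beta_reduce
    rw [← (Finset.mem_filter.1 hy).2.minimalPeriod_eq]
  have h2 : ∏ y with ¬ σ.SameCycle x y, pointWeight j (minimalPeriod (twist σ) (x, y)) =
      ∏ y with ¬ σ.SameCycle x y, w y := by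
    refine Finset.prod_congr rfl fun y hy => ?_
    rw [minimalPeriod_twist_of_not_sameCycle σ (Finset.mem_filter.1 hy).2]
  have h3 : ∏ y with σ.SameCycle x y, pointWeight j (minimalPeriod (twist σ) (x, y)) =
      factorQ j a ^ ((a : ℝ)⁻¹) := by
    rw [prod_sameCycle, ← prod_pointWeight_twist_sameCycle, ← ha,
      Real.pow_rpow_inv_natCast _ hpos.ne']
    exact Finset.prod_nonneg fun i _ => (pointWeight_pos _ _).le
  rw [h1, h2, h3]
  have := pow_pos (pointWeight_pos j (Nat.lcm 2 (Nat.lcm a a))) a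
  field_simp

theorem Finset.prod_Icc_Icc_of_comm {M : Type*} [CommMonoid M] (f : ℕ → ℕ → M)
    (hf : ∀ a b, f a b = f b a) (n : ℕ) :
    ∏ a ∈ Finset.Icc 1 n, ∏ b ∈ Finset.Icc 1 n, f a b =
      ∏ a ∈ Finset.Icc 1 n, (f a a * ∏ b ∈ Finset.Icc 1 (a - 1), f a b ^ 2) := by
  induction n with
  | zero => simp
  | succ n ih =>
    simp only [Finset.prod_Icc_succ_top (Nat.le_add_left 1 n), Finset.prod_mul_distrib] at ih ⊢
    rw [ih, Nat.add_sub_cancel, Finset.prod_pow]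
    have : ∏ a ∈ Finset.Icc 1 n, f a (n + 1) = ∏ a ∈ Finset.Icc 1 n, f (n + 1) a :=
      Finset.prod_congr rfl fun a _ => hf _ _
    rw [this, sq]
    ac_rfl

theorem factorQ_pos {n : ℕ} (j : n.Partition) (a : ℕ) : 0 < factorQ j a := by
  have := j.divisorTerm_pos
  rw [factorQ]
  split_ifs
  · exact mul_pos (this _) (pow_pos (this _) _)
  · exact pow_pos (this _) _
  · exact mul_pos (pow_pos (this _) _) (pow_pos (this _) _)

/-- Of the `k_a²` ordered pairs of cycles of length `a`, the `k_a` diagonal ones have weight `q_a`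
instead of `p_{a,a}`. For `b < a`, the pairs of lengths `(a, b)` and `(b, a)` are merged, which
gives the exponent 2. -/
theorem card_equivariant_twist {A B : Type*} [Fintype A] [DecidableEq A] [Fintype B]
    [DecidableEq B] (σ : Equiv.Perm A) (τ : Equiv.Perm B) :
    (Nat.card {f : A × A → Option B // ∀ x, f (twist σ x) = Option.map τ (f x)} : ℝ) =
      ∏ a ∈ Finset.Icc 1 (Fintype.card A),
        (factorQ τ.partition a ^ σ.partition.mult a *
          factorP τ.partition a a ^ (σ.partition.mult a ^ 2 - σ.partition.mult a) *
          ∏ b ∈ Finset.Icc 1 (a - 1),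
            factorP τ.partition a b ^ (2 * σ.partition.mult a * σ.partition.mult b)) := by
  rw [card_equivariant_option_eq_prod, Fintype.prod_prod_type]
  simp only [prod_pointWeight_twist]
  set j := τ.partition
  set k := σ.partition
  rw [prod_minimalPeriod σ fun a => factorQ j a ^ ((a : ℝ)⁻¹) *
        (pointWeight j (Nat.lcm 2 (Nat.lcm a a)) ^ a)⁻¹ *
        ∏ b ∈ Finset.Icc 1 (Fintype.card A), pointWeight j (Nat.lcm 2 (Nat.lcm a b)) ^
            (b * k.mult b)]
  have hterm : ∀ a ∈ Finset.Icc 1 (Fintype.card A), (factorQ j a ^ ((a : ℝ)⁻¹) *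
        (pointWeight j (Nat.lcm 2 (Nat.lcm a a)) ^ a)⁻¹ *
        ∏ b ∈ Finset.Icc 1 (Fintype.card A), pointWeight j (Nat.lcm 2 (Nat.lcm a b)) ^
            (b * k.mult b)) ^ (a * k.mult a) =
      (factorQ j a ^ k.mult a * (factorP j a a ^ k.mult a)⁻¹) *
        ∏ b ∈ Finset.Icc 1 (Fintype.card A), factorP j a b ^ (k.mult a * k.mult b) := by
    intro a ha
    have ha' : a ≠ 0 := by have := (Finset.mem_Icc.1 ha).1; omega
    rw [mul_pow, mul_pow, ← Finset.prod_pow, inv_pow, pow_mul, Real.rpow_inv_natCast_pow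
      (factorQ_pos j a).le ha', ← pow_mul]
    congr 1
    · congr 2
      rw [factorP_eq_pointWeight_pow, ← pow_mul, ← mul_assoc]
    · refine Finset.prod_congr rfl fun b _ => ?_
      rw [factorP_eq_pointWeight_pow, ← pow_mul, ← pow_mul]
      congr 1
      ring
  rw [Finset.prod_congr rfl hterm, Finset.prod_mul_distrib,
    Finset.prod_Icc_Icc_of_comm (fun a b => factorP j a b ^ (k.mult a * k.mult b))
      (fun a b => by rw [factorP_comm, mul_comm (k.mult a)]), ← Finset.prod_mul_distrib]
  refine Finset.prod_congr rfl fun a _ => ?_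
  rw [← mul_assoc]
  congr 1
  · rw [mul_assoc]
    congr 1
    -- The truncated subtraction in the exponent is exact.
    have hle : k.mult a ≤ k.mult a ^ 2 := Nat.le_self_pow two_ne_zero _
    rw [pow_sub₀ _ (factorP_pos j a a).ne' hle, sq, mul_comm]
  · refine Finset.prod_congr rfl fun b _ => ?_
    rw [← pow_mul]
    congr 1
    ring

/-! ### Tables, relabelings and Burnside's lemma -/

/-- Multiplication tables on a set `A` with values in a set `B` with a zero adjoined. -/
def PairTable (A B : Type*) : Type _ :=
  A × A → Option B

instance {A B : Type*} [Finite A] [Finite B] : Finite (PairTable A B) :=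
  inferInstanceAs (Finite (A × A → Option B))

/-- Relabelings of a table: permutations of the arguments, permutations of the values, and the
exchange of the two arguments. -/
abbrev TableGroup (A B : Type*) : Type _ :=
  Equiv.Perm A × Equiv.Perm B × ℤˣ

/-- Exchange the components of a pair, unless the given sign is trivial. -/
def swapBy {A : Type*} (ε : ℤˣ) (p : A × A) : A × A :=
  if ε = 1 then p else p.swap

@[simp]
theorem swapBy_one {A : Type*} (p : A × A) : swapBy 1 p = p :=
  if_pos rfl

@[simp]
theorem swapBy_neg_one {A : Type*} (p : A × A) : swapBy (-1) p = p.swap :=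
  if_neg (by decide)

instance {A B : Type*} : MulAction (TableGroup A B) (PairTable A B) where
  smul g φ := fun p => Option.map g.2.1 (φ (swapBy g.2.2 (g.1⁻¹ p.1, g.1⁻¹ p.2)))
  one_smul φ := by
    funext p
    show Option.map (1 : Equiv.Perm B) (φ (swapBy 1 ((1 : Equiv.Perm A)⁻¹ p.1, _))) = φ p
    simp
  mul_smul g h φ := by
    funext p
    obtain ⟨σ, τ, ε⟩ := g
    obtain ⟨σ', τ', ε'⟩ := h
    show Option.map (τ * τ') (φ (swapBy (ε * ε') ((σ * σ')⁻¹ p.1, (σ * σ')⁻¹ p.2))) =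
      Option.map τ (Option.map τ' (φ (swapBy ε'
        (σ'⁻¹ (swapBy ε (σ⁻¹ p.1, σ⁻¹ p.2)).1, σ'⁻¹ (swapBy ε (σ⁻¹ p.1, σ⁻¹ p.2)).2))))
    rw [Option.map_map]
    rcases Int.units_eq_one_or ε with rfl | rfl <;> rcases Int.units_eq_one_or ε' with rfl | rfl <;>
      simp

theorem PairTable.smul_apply {A B : Type*} (g : TableGroup A B) (φ : PairTable A B) (p : A × A) :
    (g • φ) p = Option.map g.2.1 (φ (swapBy g.2.2 (g.1⁻¹ p.1, g.1⁻¹ p.2))) :=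
  rfl

/-- For `φ = ψ` this describes the fixed tables; the two-table form translates isomorphisms. -/
theorem PairTable.smul_one_eq_iff {A B : Type*} (σ : Equiv.Perm A) (τ : Equiv.Perm B)
    (φ ψ : PairTable A B) :
    (σ, τ, (1 : ℤˣ)) • φ = ψ ↔ ∀ p, ψ (Equiv.prodCongr σ σ p) = Option.map τ (φ p) := by
  constructor
  · rintro rfl p
    simp [smul_apply]
  · intro h
    funext p
    have := h (σ⁻¹ p.1, σ⁻¹ p.2)
    simpa [smul_apply] using this.symm

theorem PairTable.smul_neg_one_eq_iff {A B : Type*} (σ : Equiv.Perm A) (τ : Equiv.Perm B)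
    (φ ψ : PairTable A B) :
    (σ, τ, (-1 : ℤˣ)) • φ = ψ ↔ ∀ p, ψ (twist σ p) = Option.map τ (φ p) := by
  constructor
  · rintro rfl p
    simp [smul_apply, twist]
  · intro h
    funext p
    have := h (σ⁻¹ p.2, σ⁻¹ p.1)
    simpa [smul_apply, twist] using this.symm

/-- The number of tables up to relabeling and transposition. -/
theorem card_orbits_eq_formulaL {A B : Type*} [Fintype A] [Fintype B] {p q : ℕ}
    (hB : Fintype.card B = q - 1) (hA : Fintype.card A = p - q) :
    (Nat.card (MulAction.orbitRel.Quotient (TableGroup A B) (PairTable A B)) : ℝ) =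
      formulaL p q := by
  classical
  have : Fintype (PairTable A B) := Fintype.ofFinite _
  have : Fintype (MulAction.orbitRel.Quotient (TableGroup A B) (PairTable A B)) :=
    Fintype.ofFinite _
  have burnside := MulAction.sum_card_fixedBy_eq_card_orbits_mul_card_group
    (TableGroup A B) (PairTable A B)
  have hunits : ∀ f : ℤˣ → ℝ, ∑ ε, f ε = f 1 + f (-1) := by
    intro f
    rw [show (Finset.univ : Finset ℤˣ) = {1, -1} from rfl, Finset.sum_pair (by decide)]
  have h1 : ∀ (σ : Equiv.Perm A) (τ : Equiv.Perm B),
      (Fintype.card (MulAction.fixedBy (PairTable A B) (σ, τ, (1 : ℤˣ))) : ℝ) =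
      (Nat.card {f : A × A → Option B //
        ∀ x, f (Equiv.prodCongr σ σ x) = Option.map τ (f x)} : ℝ) := by
    intro σ τ
    rw [← Nat.card_eq_fintype_card]
    exact congrArg _ (Nat.card_congr (Equiv.subtypeEquivRight fun φ =>
      PairTable.smul_one_eq_iff σ τ φ φ))
  have h2 : ∀ (σ : Equiv.Perm A) (τ : Equiv.Perm B),
      (Fintype.card (MulAction.fixedBy (PairTable A B) (σ, τ, (-1 : ℤˣ))) : ℝ) =
      (Nat.card {f : A × A → Option B // ∀ x, f (twist σ x) = Option.map τ (f x)} : ℝ) := by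
    intro σ τ
    rw [← Nat.card_eq_fintype_card]
    exact congrArg _ (Nat.card_congr (Equiv.subtypeEquivRight fun φ =>
      PairTable.smul_neg_one_eq_iff σ τ φ φ))
  have burnside' := congrArg (Nat.cast : ℕ → ℝ) burnside
  push_cast at burnside'
  simp only [Fintype.sum_prod_type, hunits, h1, h2, card_equivariant_prodCongr,
    card_equivariant_twist, Finset.sum_add_distrib] at burnside'
  rw [Finset.sum_comm, Finset.sum_comm (f := fun (σ : Equiv.Perm A) (τ : Equiv.Perm B) =>
    ∏ a ∈ Finset.Icc 1 (Fintype.card A), (factorQ τ.partition a ^ σ.partition.mult a *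
          factorP τ.partition a a ^ (σ.partition.mult a ^ 2 - σ.partition.mult a) *
          ∏ b ∈ Finset.Icc 1 (a - 1),
            factorP τ.partition a b ^ (2 * σ.partition.mult a * σ.partition.mult b)))] at burnside'
  have hsum : ∀ F : (Fintype.card B).Partition → (Fintype.card A).Partition → ℝ,
      ∑ τ : Equiv.Perm B, ∑ σ : Equiv.Perm A, F τ.partition σ.partition =
      (Fintype.card B).factorial * (Fintype.card A).factorial *
        ∑ j, ∑ k, ((j.centralizerOrder : ℝ) * (k.centralizerOrder : ℝ))⁻¹ * F j k := by
    intro F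
    simp only [sum_partition (F _)]
    rw [sum_partition fun j => (Fintype.card A).factorial *
      ∑ k, (k.centralizerOrder : ℝ)⁻¹ * F j k, mul_assoc, Finset.mul_sum (Finset.univ)
      (fun j => ∑ k, ((j.centralizerOrder : ℝ) * (k.centralizerOrder : ℝ))⁻¹ * F j k)]
    congr 1
    refine Finset.sum_congr rfl fun j _ => ?_
    rw [mul_left_comm, Finset.mul_sum]
    simp only [mul_inv, mul_assoc]
  rw [hsum fun j k => ∏ a ∈ Finset.Icc 1 (Fintype.card A), ∏ b ∈ Finset.Icc 1 (Fintype.card A),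
        (j.divisorTerm (Nat.lcm a b) : ℝ) ^ (k.mult a * k.mult b * Nat.gcd a b),
    hsum fun j k => ∏ a ∈ Finset.Icc 1 (Fintype.card A),
          (factorQ j a ^ k.mult a * factorP j a a ^ (k.mult a ^ 2 - k.mult a) *
            ∏ b ∈ Finset.Icc 1 (a - 1), factorP j a b ^ (2 * k.mult a * k.mult b))] at burnside'
  rw [formulaL, formulaN, ← hA, ← hB, Nat.card_eq_fintype_card]
  -- The two factorials cancel against `hsum`; the order 2 of `ℤˣ` leaves the halves in `L`.
  have hcard : (Fintype.card (TableGroup A B) : ℝ) =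
      2 * ((Fintype.card B).factorial * (Fintype.card A).factorial) := by
    simp only [Fintype.card_prod, Fintype.card_perm]
    rw [show Fintype.card ℤˣ = 2 from rfl]
    push_cast
    ring
  have hne : ((Fintype.card B).factorial * (Fintype.card A).factorial : ℝ) ≠ 0 := by positivity
  simp only [Fintype.card_prod, Nat.cast_mul] at hcard burnside'
  rw [hcard, ← mul_add] at burnside'
  apply mul_left_cancel₀ hne
  linear_combination (-1 / 2) * burnside'

/-! ### Full tables -/

/-- The correspondence is a relation because the representatives it matches are not canonical. -/
theorem card_quotient_subtype_eq {α β : Type*} {s : Setoid α} {t : Setoid β}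
    {p : Quotient s → Prop} {p' : Quotient t → Prop} (R : α → β → Prop)
    (h1 : ∀ a, p (Quotient.mk s a) → ∃ b, p' (Quotient.mk t b) ∧ R a b)
    (h2 : ∀ b, p' (Quotient.mk t b) → ∃ a, p (Quotient.mk s a) ∧ R a b)
    (h3 : ∀ {a a' b b'}, R a b → R a' b' → (s a a' ↔ t b b')) :
    Nat.card {q // p q} = Nat.card {q // p' q} := by
  have hp : ∀ q : {q // p q}, p (Quotient.mk s q.1.out) := by
    intro q
    rw [Quotient.out_eq]
    exact q.2
  choose f hf hR using fun q : {q // p q} => h1 q.1.out (hp q)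
  apply Nat.card_congr
  refine Equiv.ofBijective (fun q => ⟨Quotient.mk t (f q), hf q⟩) ⟨?_, ?_⟩
  · intro q q' h
    have h' := Quotient.exact (congrArg Subtype.val h)
    have := Quotient.sound ((h3 (hR q) (hR q')).2 h')
    rw [Quotient.out_eq, Quotient.out_eq] at this
    exact Subtype.ext this
  · rintro ⟨q, hq⟩
    induction q using Quotient.inductionOn with
    | h b =>
      obtain ⟨a, ha, hab⟩ := h2 b hq
      refine ⟨⟨Quotient.mk s a, ha⟩, Subtype.ext (Quotient.sound ?_)⟩
      exact (h3 (hR _) hab).1 (Quotient.mk_out a)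

/-- Every value other than the zero occurs in the table. -/
def PairTable.IsFull {A B : Type*} (φ : PairTable A B) : Prop :=
  ∀ b, ∃ p, φ p = some b

theorem PairTable.IsFull.smul {A B : Type*} {φ : PairTable A B} (h : φ.IsFull)
    (g : TableGroup A B) : (g • φ).IsFull := by
  intro b
  obtain ⟨p, hp⟩ := h (g.2.1⁻¹ b)
  obtain ⟨σ, τ, ε⟩ := g
  rcases Int.units_eq_one_or ε with rfl | rfl
  · refine ⟨(σ p.1, σ p.2), ?_⟩
    simpa [smul_apply] using ⟨_, hp, by simp⟩
  · refine ⟨(σ p.2, σ p.1), ?_⟩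
    simpa [smul_apply] using ⟨_, hp, by simp⟩

/-- Fullness as a property of orbits. -/
def IsFullOrbit {A B : Type*}
    (q : MulAction.orbitRel.Quotient (TableGroup A B) (PairTable A B)) : Prop :=
  Quotient.liftOn q PairTable.IsFull fun φ ψ h => by
    obtain ⟨g, rfl⟩ := MulAction.mem_orbit_iff.1 (MulAction.orbitRel_apply.1 h)
    refine propext ⟨fun h => ?_, fun h => h.smul g⟩
    simpa using h.smul g⁻¹

/-- Enlarge the set of values by one element that does not occur. -/
def PairTable.lift {A B : Type*} (φ : PairTable A B) : PairTable A (Option B) :=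
  fun p => Option.map some (φ p)

/-- A relabeling `τ` of the enlarged values may move `none`, but it sends values occurring in
`ψ.lift` to values other than `none`, and there `Equiv.removeNone τ` agrees with it. -/
theorem PairTable.lift_mem_orbit_iff {A B : Type*} (φ ψ : PairTable A B) :
    φ.lift ∈ MulAction.orbit (TableGroup A (Option B)) ψ.lift ↔
      φ ∈ MulAction.orbit (TableGroup A B) ψ := by
  simp only [MulAction.mem_orbit_iff]
  constructor
  · rintro ⟨⟨σ, τ, ε⟩, h⟩
    refine ⟨(σ, Equiv.removeNone τ, ε), ?_⟩
    funext p
    have hp := congrFun h p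
    simp only [smul_apply, lift] at hp ⊢
    cases hψ : ψ (swapBy ε (σ⁻¹ p.1, σ⁻¹ p.2)) with
    | none => cases hφ : φ p <;> simp_all
    | some b =>
      cases hφ : φ p with
      | none => simp_all
      | some c =>
        have hτ : τ (some b) = some c := by
          rw [hψ, hφ] at hp
          simpa using hp
        have := Equiv.removeNone_some τ ⟨c, hτ⟩
        rw [hτ, Option.some_inj] at this
        simp [this]
  · rintro ⟨⟨σ, τ, ε⟩, rfl⟩
    refine ⟨(σ, Equiv.optionCongr τ, ε), ?_⟩
    funext p
    simp only [smul_apply, lift, Option.map_map]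
    rfl

theorem PairTable.exists_lift_mem_orbit {A B : Type*} {φ : PairTable A (Option B)}
    (h : ¬ φ.IsFull) :
    ∃ ψ : PairTable A B, φ ∈ MulAction.orbit (TableGroup A (Option B)) ψ.lift := by
  classical
  simp only [IsFull, not_forall, not_exists] at h
  obtain ⟨b, hb⟩ := h
  -- Moves the missing value to the added place `none`.
  let g : TableGroup A (Option B) := (1, Equiv.swap b none, 1)
  have hg : ∀ p, (g • φ) p ≠ some none := by
    intro p hp
    simp only [g, smul_apply, Option.map_eq_some_iff] at hp
    obtain ⟨c, hc, hc'⟩ := hp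
    rw [Equiv.swap_apply_eq_iff, Equiv.swap_apply_right] at hc'
    exact hb _ (hc' ▸ hc)
  refine ⟨fun p => ((g • φ) p).join, MulAction.mem_orbit_symm.1 ⟨g, ?_⟩⟩
  funext p
  show (g • φ) p = Option.map some ((g • φ) p).join
  have := hg p
  generalize (g • φ) p = o at this ⊢
  rcases o with _ | _ | c
  · rfl
  · exact absurd rfl this
  · rfl

theorem PairTable.not_isFull_of_mem_orbit_lift {A B : Type*} {φ : PairTable A (Option B)}
    {ψ : PairTable A B} (h : φ ∈ MulAction.orbit (TableGroup A (Option B)) ψ.lift) :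
    ¬ φ.IsFull := by
  intro hφ
  obtain ⟨g, hg⟩ := MulAction.mem_orbit_symm.1 h
  obtain ⟨p, hp⟩ := hφ.smul g none
  rw [show g • φ = ψ.lift from hg] at hp
  simp [lift] at hp

theorem card_isFullOrbit_add {A B : Type*} [Finite A] [Finite B] :
    Nat.card {q : MulAction.orbitRel.Quotient (TableGroup A (Option B)) (PairTable A (Option B)) //
        IsFullOrbit q} +
      Nat.card (MulAction.orbitRel.Quotient (TableGroup A B) (PairTable A B)) =
      Nat.card (MulAction.orbitRel.Quotient (TableGroup A (Option B))
        (PairTable A (Option B))) := by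
  classical
  rw [← Nat.card_congr (Equiv.sumCompl (IsFullOrbit (A := A) (B := Option B))), Nat.card_sum]
  congr 1
  rw [← Nat.card_congr (Equiv.subtypeUnivEquiv (p := fun _ :
    MulAction.orbitRel.Quotient (TableGroup A B) (PairTable A B) => True) fun _ => trivial)]
  symm
  refine card_quotient_subtype_eq
    (fun φ ψ => φ ∈ MulAction.orbit (TableGroup A (Option B)) ψ.lift) ?_ ?_ ?_
  · intro φ hφ
    obtain ⟨ψ, hψ⟩ := PairTable.exists_lift_mem_orbit hφ
    exact ⟨ψ, trivial, hψ⟩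
  · intro ψ _
    have := MulAction.mem_orbit_self (M := TableGroup A (Option B)) ψ.lift
    exact ⟨ψ.lift, PairTable.not_isFull_of_mem_orbit_lift this, this⟩
  · intro φ φ' ψ ψ' h h'
    rw [MulAction.orbitRel_apply, MulAction.orbitRel_apply, ← PairTable.lift_mem_orbit_iff ψ ψ',
      ← MulAction.orbit_eq_iff, ← MulAction.orbit_eq_iff, MulAction.orbit_eq_iff.2 h,
      MulAction.orbit_eq_iff.2 h']

/-! ### Nilpotency of degree 3 -/

theorem mem_productSet_one {S : Type*} [Semigroup S] (x : S) : x ∈ productSet S 1 :=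
  ⟨x, [], rfl, rfl⟩

theorem mem_productSet_two {S : Type*} [Semigroup S] {x : S} :
    x ∈ productSet S 2 ↔ ∃ s t, s * t = x := by
  constructor
  · rintro ⟨s, l, hl, rfl⟩
    obtain ⟨t, rfl⟩ := List.length_eq_one_iff.1 (show l.length = 1 by omega)
    exact ⟨s, t, rfl⟩
  · rintro ⟨s, t, rfl⟩
    exact ⟨s, [t], rfl, rfl⟩

theorem mem_productSet_three {S : Type*} [Semigroup S] {x : S} :
    x ∈ productSet S 3 ↔ ∃ s t u, s * t * u = x := by
  constructor
  · rintro ⟨s, l, hl, rfl⟩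
    obtain ⟨t, u, rfl⟩ := List.length_eq_two.1 (show l.length = 2 by omega)
    exact ⟨s, t, u, rfl⟩
  · rintro ⟨s, t, u, rfl⟩
    exact ⟨s, [t, u], rfl, rfl⟩

theorem isNilpotentOfDegree_three_iff {S : Type*} [Semigroup S] :
    IsNilpotentOfDegree S 3 ↔ (productSet S 1).ncard ≠ 1 ∧ (productSet S 2).ncard ≠ 1 ∧
      ∃ z : S, ∀ x y w : S, x * y * w = z := by
  have h3 : (productSet S 3).ncard = 1 ↔ ∃ z : S, ∀ x y w : S, x * y * w = z := by
    rw [Set.ncard_eq_one]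
    constructor
    · rintro ⟨z, hz⟩
      exact ⟨z, fun x y w => by
        have : x * y * w ∈ productSet S 3 := mem_productSet_three.2 ⟨x, y, w, rfl⟩
        rwa [hz] at this⟩
    · rintro ⟨z, hz⟩
      refine ⟨z, Set.ext fun x => ?_⟩
      rw [mem_productSet_three, Set.mem_singleton_iff]
      exact ⟨fun ⟨s, t, u, h⟩ => h ▸ hz s t u, fun h => ⟨z, z, z, h ▸ hz z z z⟩⟩
  rw [← h3]
  constructor
  · rintro ⟨⟨-, h⟩, hl⟩
    refine ⟨fun h1 => ?_, fun h2 => ?_, h⟩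
    · have := hl ⟨le_refl 1, h1⟩
      omega
    · have := hl ⟨one_le_two, h2⟩
      omega
  · rintro ⟨h1, h2, h⟩
    refine ⟨⟨by omega, h⟩, ?_⟩
    rintro t ⟨ht, ht'⟩
    by_contra hlt
    have : t = 1 ∨ t = 2 := by omega
    rcases this with rfl | rfl
    · exact h1 ht'
    · exact h2 ht'

/-! ### Semigroups given by tables -/

/-- The multiplication on `A ∪ B ∪ {0}` given by a table on `A`, all other products being zero. -/
def tableMul {A B : Type*} (φ : PairTable A B) : A ⊕ Option B → A ⊕ Option B → A ⊕ Option B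
  | Sum.inl a, Sum.inl a' => Sum.inr (φ (a, a'))
  | _, _ => Sum.inr none

@[simp]
theorem tableMul_inl_inl {A B : Type*} (φ : PairTable A B) (a a' : A) :
    tableMul φ (Sum.inl a) (Sum.inl a') = Sum.inr (φ (a, a')) :=
  rfl

@[simp]
theorem tableMul_inr_left {A B : Type*} (φ : PairTable A B) (o : Option B) (u : A ⊕ Option B) :
    tableMul φ (Sum.inr o) u = Sum.inr none :=
  rfl

@[simp]
theorem tableMul_inr_right {A B : Type*} (φ : PairTable A B) (o : Option B) (u : A ⊕ Option B) :
    tableMul φ u (Sum.inr o) = Sum.inr none := by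
  cases u <;> rfl

theorem exists_tableMul_eq_inr {A B : Type*} (φ : PairTable A B) (u v : A ⊕ Option B) :
    ∃ o, tableMul φ u v = Sum.inr o := by
  rcases u with a | o <;> rcases v with a' | o' <;> simp

theorem PairTable.IsFull.exists_tableMul_eq {A B : Type*} {φ : PairTable A B} (h : φ.IsFull)
    (o : Option B) : ∃ u v, tableMul φ u v = Sum.inr o := by
  cases o with
  | none => exact ⟨Sum.inr none, Sum.inr none, rfl⟩
  | some b =>
    obtain ⟨p, hp⟩ := h b
    exact ⟨Sum.inl p.1, Sum.inl p.2, congrArg Sum.inr hp⟩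

theorem tableMul_tableMul {A B : Type*} (φ : PairTable A B) (u v w : A ⊕ Option B) :
    tableMul φ (tableMul φ u v) w = Sum.inr none := by
  obtain ⟨o, h⟩ := exists_tableMul_eq_inr φ u v
  rw [h, tableMul_inr_left]

theorem tableMul_tableMul' {A B : Type*} (φ : PairTable A B) (u v w : A ⊕ Option B) :
    tableMul φ u (tableMul φ v w) = Sum.inr none := by
  obtain ⟨o, h⟩ := exists_tableMul_eq_inr φ v w
  rw [h, tableMul_inr_right]

/-- The table with the two arguments exchanged. -/
def PairTable.transpose {A B : Type*} (φ : PairTable A B) : PairTable A B :=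
  fun p => φ p.swap

theorem tableMul_transpose {A B : Type*} (φ : PairTable A B) (u v : A ⊕ Option B) :
    tableMul φ.transpose u v = tableMul φ v u := by
  rcases u with a | o <;> rcases v with a' | o' <;> simp [PairTable.transpose]

/-- By fullness `B ∪ {0}` consists of products, so it is mapped into itself, and by finiteness so is
`A`. -/
theorem exists_perm_of_tableMul_equiv {A B : Type*} [Finite A] [Finite B] {φ ψ : PairTable A B}
    (hφ : φ.IsFull) (h : Equiv.Perm (A ⊕ Option B))
    (hh : ∀ u v, h (tableMul φ u v) = tableMul ψ (h u) (h v)) :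
    ∃ (σ : Equiv.Perm A) (τ : Equiv.Perm B),
      ∀ p, ψ (Equiv.prodCongr σ σ p) = Option.map τ (φ p) := by
  have hinr : Set.MapsTo h (Set.range Sum.inr) (Set.range Sum.inr) := by
    rintro _ ⟨o, rfl⟩
    obtain ⟨u, v, huv⟩ := hφ.exists_tableMul_eq o
    rw [← huv, hh]
    obtain ⟨o', ho'⟩ := exists_tableMul_eq_inr ψ (h u) (h v)
    exact ⟨o', ho'.symm⟩
  obtain ⟨⟨σ, ρ⟩, rfl⟩ :=
    mem_sumCongrHom_range_of_perm_mapsTo_inl ((perm_mapsTo_inl_iff_mapsTo_inr h).2 hinr)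
  -- Zero is a triple product, and all triple products agree.
  have hρ : ρ none = none := by
    have := hh (tableMul φ (Sum.inr none) (Sum.inr none)) (Sum.inr none)
    rw [hh (Sum.inr none), tableMul_tableMul, tableMul_tableMul] at this
    simpa using this
  refine ⟨σ, Equiv.removeNone ρ, fun p => ?_⟩
  have hp : Sum.inr (ρ (φ p)) = (Sum.inr (ψ (σ p.1, σ p.2)) : A ⊕ Option B) :=
    hh (Sum.inl p.1) (Sum.inl p.2)
  rw [Sum.inr.injEq] at hp
  show ψ (σ p.1, σ p.2) = _
  rw [← hp]
  cases φ p with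
  | none => exact hρ
  | some b =>
    refine (Equiv.removeNone_some ρ (Option.ne_none_iff_exists'.1 fun hb => ?_)).symm
    exact Option.some_ne_none b (ρ.injective (hb.trans hρ.symm))

/-- The multiplication of `X` is given by the table `φ`, under an identification of `X`. -/
def IsModel {A B X : Type*} [Mul X] (e : A ⊕ Option B ≃ X) (φ : PairTable A B) : Prop :=
  ∀ u v, e u * e v = e (tableMul φ u v)

theorem isoOrAntiIso_iff_mem_orbit {A B X Y : Type*} [Finite A] [Finite B] [Semigroup X]
    [Semigroup Y] {e : A ⊕ Option B ≃ X} {e' : A ⊕ Option B ≃ Y} {φ ψ : PairTable A B}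
    (hφ : φ.IsFull) (h : IsModel e φ) (h' : IsModel e' ψ) :
    IsoOrAntiIso X Y ↔ ψ ∈ MulAction.orbit (TableGroup A B) φ := by
  rw [MulAction.mem_orbit_iff]
  constructor
  · rintro (⟨⟨f⟩⟩ | ⟨⟨f⟩⟩)
    · obtain ⟨σ, τ, H⟩ := exists_perm_of_tableMul_equiv (ψ := ψ) hφ
        ((e.trans f.toEquiv).trans e'.symm) fun u v => by
          simp only [Equiv.trans_apply, MulEquiv.toEquiv_eq_coe,
            EquivLike.coe_coe]
          rw [← h, Equiv.symm_apply_eq, ← h']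
          simp
      exact ⟨_, (PairTable.smul_one_eq_iff σ τ φ ψ).2 H⟩
    -- An anti-isomorphism is an isomorphism onto the transposed table, that is, a relabeling with
    -- sign `-1`.
    · obtain ⟨σ, τ, H⟩ := exists_perm_of_tableMul_equiv (ψ := ψ.transpose) hφ
        ((e.trans (MulOpposite.opEquiv.trans f.toEquiv)).trans e'.symm) fun u v => by
          simp only [Equiv.trans_apply, MulEquiv.toEquiv_eq_coe,
            EquivLike.coe_coe, MulOpposite.opEquiv_apply]
          rw [← h, Equiv.symm_apply_eq, tableMul_transpose, ← h']
          simp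
      exact ⟨_, (PairTable.smul_neg_one_eq_iff σ τ φ ψ).2 fun p => H p⟩
  · rintro ⟨⟨σ, τ, ε⟩, hg⟩
    let k : A ⊕ Option B ≃ A ⊕ Option B := Equiv.sumCongr σ (Equiv.optionCongr τ)
    rcases Int.units_eq_one_or ε with rfl | rfl
    · rw [PairTable.smul_one_eq_iff] at hg
      have hk : ∀ u v, k (tableMul φ u v) = tableMul ψ (k u) (k v) := by
        rintro (a | o) (a' | o')
        · exact congrArg Sum.inr (hg (a, a')).symm
        all_goals simp [k]
      refine Or.inl ⟨⟨(e.symm.trans k).trans e', fun x y => ?_⟩⟩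
      obtain ⟨u, rfl⟩ := e.surjective x
      obtain ⟨v, rfl⟩ := e.surjective y
      simp [h u v, hk, h' (k u) (k v)]
    · rw [PairTable.smul_neg_one_eq_iff] at hg
      have hk : ∀ u v, k (tableMul φ u v) = tableMul ψ (k v) (k u) := by
        rintro (a | o) (a' | o')
        · exact congrArg Sum.inr (hg (a, a')).symm
        all_goals simp [k]
      refine Or.inr ⟨⟨MulOpposite.opEquiv.symm.trans ((e.symm.trans k).trans e'), fun x y => ?_⟩⟩
      obtain ⟨u, hu⟩ := e.surjective x.unop
      obtain ⟨v, hv⟩ := e.surjective y.unop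
      simp [← hu, ← hv, h v u, hk, h' (k u) (k v)]

theorem IsModel.productSet_two {A B X : Type*} [Semigroup X] {e : A ⊕ Option B ≃ X}
    {φ : PairTable A B} (h : IsModel e φ) (hφ : φ.IsFull) :
    productSet X 2 = Set.range fun o : Option B => e (Sum.inr o) := by
  ext x
  rw [mem_productSet_two]
  constructor
  · rintro ⟨s, t, rfl⟩
    obtain ⟨u, rfl⟩ := e.surjective s
    obtain ⟨v, rfl⟩ := e.surjective t
    obtain ⟨o, ho⟩ := exists_tableMul_eq_inr φ u v
    exact ⟨o, by rw [h, ho]⟩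
  · rintro ⟨o, rfl⟩
    obtain ⟨u, v, huv⟩ := hφ.exists_tableMul_eq o
    exact ⟨e u, e v, by rw [h, huv]⟩

theorem IsModel.ncard_productSet_two {A B X : Type*} [Finite B] [Semigroup X]
    {e : A ⊕ Option B ≃ X} {φ : PairTable A B} (h : IsModel e φ) (hφ : φ.IsFull) :
    (productSet X 2).ncard = Nat.card B + 1 := by
  have hinj : Injective fun o : Option B => e (Sum.inr o) := e.injective.comp Sum.inr_injective
  rw [h.productSet_two hφ, ← Set.image_univ, Set.ncard_image_of_injective _ hinj, Set.ncard_univ,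
    Finite.card_option]

theorem IsModel.isNilpotentOfDegree_three {A B X : Type*} [Finite B] [Nonempty B]
    [Finite X] [Semigroup X] {e : A ⊕ Option B ≃ X} {φ : PairTable A B} (h : IsModel e φ)
    (hφ : φ.IsFull) : IsNilpotentOfDegree X 3 := by
  have h2 := h.ncard_productSet_two hφ
  have hB : 0 < Nat.card B := Nat.card_pos
  have hle : (productSet X 2).ncard ≤ (productSet X 1).ncard :=
    Set.ncard_le_ncard (fun x _ => mem_productSet_one x) (Set.toFinite _)
  refine isNilpotentOfDegree_three_iff.2 ⟨by omega, by omega, e (Sum.inr none), ?_⟩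
  intro x y w
  obtain ⟨u, rfl⟩ := e.surjective x
  obtain ⟨v, rfl⟩ := e.surjective y
  obtain ⟨t, rfl⟩ := e.surjective w
  rw [h, h, tableMul_tableMul]

theorem exists_isModel_of_equiv {A B X : Type*} (e : A ⊕ Option B ≃ X) (φ : PairTable A B) :
    ∃ M : Semigroup X, @IsModel A B X M.toMul e φ :=
  ⟨{ mul := fun x y => e (tableMul φ (e.symm x) (e.symm y))
     mul_assoc := fun x y z => by
      show e (tableMul φ (e.symm (e _)) _) = e (tableMul φ _ (e.symm (e _)))
      simp only [Equiv.symm_apply_apply, tableMul_tableMul, tableMul_tableMul'] }, fun u v => by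
      show e (tableMul φ (e.symm (e u)) (e.symm (e v))) = _
      simp only [Equiv.symm_apply_apply]⟩

theorem two_le_ncard_productSet_two {X : Type*} [Semigroup X] [Finite X]
    (hX : IsNilpotentOfDegree X 3) : 2 ≤ (productSet X 2).ncard := by
  obtain ⟨-, h2, z, hz⟩ := isNilpotentOfDegree_three_iff.1 hX
  have : 0 < (productSet X 2).ncard :=
    (Set.ncard_pos (Set.toFinite _)).2 ⟨z * z, mem_productSet_two.2 ⟨z, z, rfl⟩⟩
  omega

/-- `A` labels the complement of `S²` and `B` labels `S²` without zero. The factors of a nonzero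
product lie outside `S²`, which gives fullness. -/
theorem IsNilpotentOfDegree.exists_isModel {A B X : Type*} [Finite A] [Finite B] [Semigroup X]
    [Finite X] (hX : IsNilpotentOfDegree X 3) (hB : Nat.card B + 1 = (productSet X 2).ncard)
    (hA : Nat.card A + (productSet X 2).ncard = Nat.card X) :
    ∃ (e : A ⊕ Option B ≃ X) (φ : PairTable A B), IsModel e φ ∧ φ.IsFull := by
  classical
  obtain ⟨-, -, z, hz⟩ := isNilpotentOfDegree_three_iff.1 hX
  have hz2 : z ∈ productSet X 2 := mem_productSet_two.2 ⟨z * z, z, hz z z z⟩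
  obtain ⟨g₀⟩ : Nonempty (Option B ≃ productSet X 2) := by
    rw [← Finite.card_eq, Finite.card_option, hB, Nat.card_coe_set_eq]
  -- The swap makes `none` correspond to the zero.
  let g : Option B ≃ productSet X 2 := g₀.trans (Equiv.swap (g₀ none) ⟨z, hz2⟩)
  have hg : g none = ⟨z, hz2⟩ := Equiv.swap_apply_left _ _
  obtain ⟨f⟩ : Nonempty (A ≃ ((productSet X 2)ᶜ : Set X)) := by
    rw [← Finite.card_eq, Nat.card_coe_set_eq]
    have := Set.ncard_add_ncard_compl (productSet X 2)
    omega
  let e : A ⊕ Option B ≃ X :=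
    ((Equiv.sumCongr f g).trans (Equiv.sumComm _ _)).trans (Equiv.Set.sumCompl (productSet X 2))
  have he1 : ∀ a, e (Sum.inl a) = (f a : X) := fun a => rfl
  have he2 : ∀ o, e (Sum.inr o) = (g o : X) := fun o => rfl
  have hzero : ∀ x y, x ∈ productSet X 2 ∨ y ∈ productSet X 2 → x * y = z := by
    rintro x y (hx | hy)
    · obtain ⟨s, t, rfl⟩ := mem_productSet_two.1 hx
      exact hz s t y
    · obtain ⟨s, t, rfl⟩ := mem_productSet_two.1 hy
      rw [← mul_assoc]
      exact hz x s t
  let φ : PairTable A B := fun p =>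
    g.symm ⟨(f p.1 : X) * (f p.2 : X), mem_productSet_two.2 ⟨_, _, rfl⟩⟩
  refine ⟨e, φ, ?_, ?_⟩
  · rintro (a | o) (a' | o')
    · rw [tableMul_inl_inl, he2, he1, he1]
      simp [φ]
    · rw [tableMul_inr_right, he2 none, hg, he2]
      exact hzero _ _ (Or.inr (g o').2)
    · rw [tableMul_inr_left, he2 none, hg, he2]
      exact hzero _ _ (Or.inl (g o).2)
    · rw [tableMul_inr_left, he2 none, hg, he2]
      exact hzero _ _ (Or.inl (g o).2)
  · intro b
    obtain ⟨s, t, hst⟩ := mem_productSet_two.1 (g (some b)).2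
    have hne : (g (some b) : X) ≠ z := by
      intro h
      have : g (some b) = g none := by
        rw [hg]
        exact Subtype.ext h
      exact Option.some_ne_none b (g.injective this)
    have hs : s ∈ (productSet X 2)ᶜ := fun h => hne (hst.symm.trans (hzero s t (Or.inl h)))
    have ht : t ∈ (productSet X 2)ᶜ := fun h => hne (hst.symm.trans (hzero s t (Or.inr h)))
    refine ⟨(f.symm ⟨s, hs⟩, f.symm ⟨t, ht⟩), ?_⟩
    simp only [φ, Equiv.apply_symm_apply, Equiv.symm_apply_eq]
    exact Subtype.ext hst

/-! ### Classes sorted by the size of `S²` -/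

theorem IsoOrAntiIso.ncard_productSet_two {S T : Type*} [Semigroup S] [Semigroup T]
    (h : IsoOrAntiIso S T) : (productSet S 2).ncard = (productSet T 2).ncard := by
  rcases h with ⟨⟨f⟩⟩ | ⟨⟨f⟩⟩
  · rw [← Set.ncard_image_of_injective _ f.injective]
    congr 1
    ext x
    simp only [Set.mem_image, mem_productSet_two]
    constructor
    · rintro ⟨_, ⟨s, t, rfl⟩, rfl⟩
      exact ⟨f s, f t, (map_mul f s t).symm⟩
    · rintro ⟨s, t, rfl⟩
      exact ⟨_, ⟨f.symm s, f.symm t, rfl⟩, by simp⟩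
  · rw [← Set.ncard_image_of_injective _ (f.injective.comp MulOpposite.op_injective)]
    congr 1
    ext x
    simp only [Set.mem_image, mem_productSet_two, comp_apply]
    constructor
    · rintro ⟨_, ⟨s, t, rfl⟩, rfl⟩
      exact ⟨f (MulOpposite.op t), f (MulOpposite.op s), by rw [MulOpposite.op_mul, map_mul]⟩
    · rintro ⟨s, t, rfl⟩
      exact ⟨_, ⟨(f.symm t).unop, (f.symm s).unop, rfl⟩, by simp⟩

/-- The number of elements of `S²`, for a class `S` of nilpotent semigroups of degree `3`. -/
noncomputable def squareCard {X : Type*} (q : Quotient (isoOrAntiIsoSetoid X)) : ℕ :=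
  Quotient.liftOn q (fun M => (@productSet X M.1 2).ncard) fun M M' h =>
    @IsoOrAntiIso.ncard_productSet_two X X M.1 M'.1 h

instance {X : Type*} [Finite X] : Finite (NilpotentDegThree X) := by
  have : Finite (Semigroup X) := by
    refine Finite.of_injective (fun M : Semigroup X => M.toMul.mul) fun M M' h => ?_
    exact Semigroup.ext h
  exact inferInstanceAs (Finite {M : Semigroup X // @IsNilpotentOfDegree X M 3})

instance {X : Type*} [Finite X] : Finite (Quotient (isoOrAntiIsoSetoid X)) :=
  Quotient.finite _

/-- Classes of semigroups with `|S²| = |B| + 1` correspond to classes of full tables. -/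
theorem card_squareCard_eq {A B X : Type*} [Finite A] [Finite B] [Nonempty B] [Finite X]
    (hX : Nat.card A + (Nat.card B + 1) = Nat.card X) :
    Nat.card {q : Quotient (isoOrAntiIsoSetoid X) // squareCard q = Nat.card B + 1} =
      Nat.card {q : MulAction.orbitRel.Quotient (TableGroup A B) (PairTable A B) //
        IsFullOrbit q} := by
  refine card_quotient_subtype_eq (fun M φ => φ.IsFull ∧ ∃ e : A ⊕ Option B ≃ X,
    @IsModel A B X M.1.toMul e φ) ?_ ?_ ?_
  · intro M hM
    have hM' : (@productSet X M.1 2).ncard = Nat.card B + 1 := hM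
    let := M.1
    obtain ⟨e, φ, he, hφ⟩ := IsNilpotentOfDegree.exists_isModel (A := A) (B := B) M.2 hM'.symm
      (by rw [hM']; exact hX)
    exact ⟨φ, hφ, hφ, e, he⟩
  · intro φ hφ
    obtain ⟨e⟩ : Nonempty (A ⊕ Option B ≃ X) := by
      rw [← Finite.card_eq, Nat.card_sum, Finite.card_option, hX]
    obtain ⟨M, hM⟩ := exists_isModel_of_equiv e φ
    refine ⟨⟨M, hM.isNilpotentOfDegree_three hφ⟩, ?_, hφ, e, hM⟩
    exact hM.ncard_productSet_two hφ
  · rintro M M' φ φ' ⟨hφ, e, he⟩ ⟨-, e', he'⟩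
    rw [MulAction.orbitRel_apply, MulAction.mem_orbit_symm]
    exact @isoOrAntiIso_iff_mem_orbit A B X X _ _ M.1 M'.1 e e' φ φ' hφ he he'

/-! ### The bound `a(n)` and the final sum -/

/-- With `t = n - m`, the inequality `m ≤ t² + 1` says `n - 3/4 ≤ (t + 1/2)²`. -/
theorem le_boundA {n m : ℕ} (hm : m ≤ n) (h : m ≤ (n - m) ^ 2 + 1) :
    m ≤ boundA n := by
  obtain ⟨t, rfl⟩ := Nat.exists_eq_add_of_le hm
  rw [Nat.add_sub_cancel_left] at h
  apply Nat.le_floor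
  have h' : (m : ℝ) ≤ (t : ℝ) ^ 2 + 1 := by exact_mod_cast h
  have : √(((m + t : ℕ) : ℝ) - 3 / 4) ≤ t + 1 / 2 := by
    rw [Real.sqrt_le_left (by positivity)]
    push_cast
    nlinarith
  push_cast at this ⊢
  linarith

theorem boundA_le (n : ℕ) (hn : 1 ≤ n) : boundA n ≤ n := by
  apply Nat.floor_le_of_le
  have hn' : (1 : ℝ) ≤ n := by exact_mod_cast hn
  have : (1 / 2 : ℝ) ≤ √((n : ℝ) - 3 / 4) := by
    apply Real.le_sqrt_of_sq_le
    nlinarith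
  linarith

theorem IsNilpotentOfDegree.ncard_productSet_two_mem_Icc {X : Type*} [Semigroup X] [Finite X]
    (hX : IsNilpotentOfDegree X 3) :
    (productSet X 2).ncard ∈ Finset.Icc 2 (boundA (Nat.card X)) := by
  have h2 := two_le_ncard_productSet_two hX
  have hle : (productSet X 2).ncard ≤ Nat.card X := Set.ncard_le_card _
  refine Finset.mem_Icc.2 ⟨h2, le_boundA hle ?_⟩
  obtain ⟨-, φ, -, hφ⟩ := hX.exists_isModel
    (A := Fin (Nat.card X - (productSet X 2).ncard)) (B := Fin ((productSet X 2).ncard - 1))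
    (by rw [Nat.card_fin]; omega) (by rw [Nat.card_fin]; omega)
  -- Choosing a position for each value embeds `B` in `A × A`, so `m - 1 ≤ (n - m)²`.
  choose f hf using hφ
  have hinj : Injective f := fun b b' h => by
    have := hf b
    rw [h, hf b', Option.some_inj] at this
    exact this.symm
  have := Nat.card_le_card_of_injective f hinj
  rw [Nat.card_prod, Nat.card_fin, Nat.card_fin, ← sq] at this
  omega

theorem card_squareCard_eq_formulaL_sub {X : Type*} [Finite X] {m : ℕ} (h2 : 2 ≤ m)
    (hm : m ≤ Nat.card X) :
    (Nat.card {q : Quotient (isoOrAntiIsoSetoid X) // squareCard q = m} : ℝ) =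
      formulaL (Nat.card X) m - formulaL (Nat.card X - 1) (m - 1) := by
  -- As `m ≥ 2`, the `m - 1` values can be written as an `Option`; removing one leaves `A`
  -- unchanged, since `(n - 1) - (m - 1) = n - m`.
  have hB : Nat.card (Option (Fin (m - 2))) + 1 = m := by
    rw [Finite.card_option, Nat.card_fin]
    omega
  have h := card_squareCard_eq (A := Fin (Nat.card X - m)) (B := Option (Fin (m - 2))) (X := X)
    (by rw [Nat.card_fin]; omega)
  rw [hB] at h
  have hadd := card_isFullOrbit_add (A := Fin (Nat.card X - m)) (B := Fin (m - 2))
  rw [← h] at hadd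
  have hadd' := congrArg (Nat.cast : ℕ → ℝ) hadd
  rw [Nat.cast_add,
    card_orbits_eq_formulaL (B := Option (Fin (m - 2))) (p := Nat.card X) (q := m)
      (by rw [Fintype.card_option, Fintype.card_fin]; omega) (by rw [Fintype.card_fin]),
    card_orbits_eq_formulaL (B := Fin (m - 2)) (p := Nat.card X - 1) (q := m - 1)
      (by rw [Fintype.card_fin]; omega) (by rw [Fintype.card_fin]; omega)] at hadd'
  linarith

theorem theorem2p3 (n : ℕ) (hn : 1 ≤ n) (X : Type*) [Finite X] (hX : Nat.card X = n) :
    (numNilpotentUpToEquiv X : ℝ) =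
      ∑ m ∈ Finset.Icc 2 (boundA n), (formulaL n m - formulaL (n - 1) (m - 1)) := by
  classical
  subst hX
  have : Fintype (Quotient (isoOrAntiIsoSetoid X)) := Fintype.ofFinite _
  have hmaps : ∀ q : Quotient (isoOrAntiIsoSetoid X),
      squareCard q ∈ Finset.Icc 2 (boundA (Nat.card X)) := by
    intro q
    induction q using Quotient.inductionOn with
    | h M => exact @IsNilpotentOfDegree.ncard_productSet_two_mem_Icc X M.1 _ M.2
  rw [numNilpotentUpToEquiv, Nat.card_eq_fintype_card, ← Finset.card_univ,
    Finset.card_eq_sum_card_fiberwise (fun q _ => hmaps q), Nat.cast_sum]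
  refine Finset.sum_congr rfl fun m hm => ?_
  obtain ⟨h2, hle⟩ := Finset.mem_Icc.1 hm
  rw [← card_squareCard_eq_formulaL_sub h2 (hle.trans (boundA_le _ hn)), Nat.card_eq_fintype_card,
    Fintype.card_subtype]
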